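/- Let $n \ge 2$ and let $\kappa : \mathbb{R} \to \mathbb{R}^n$ be a polynomial knot, i.e. a map whose components are polynomials, with $\kappa(s) \ne \kappa(t)$ for all $s \ne t$ and $\kappa'(t) \ne 0$ for all $t$. For $k \ge 1$ let $S^k \subset \mathbb{R}^{k+1}$ be the unit sphere and let $$\sigma_k : \mathbb{R}^k \cup \{\infty\} \to S^k, \qquad \sigma_k(x) = \left(\frac{2x}{|x|^2+1}, \frac{|x|^2-1}{|x|^2+1}\right), \quad \sigma_k(\infty) = (0,\dots,0,1),$$ be stereographic projection. Let the completion $\bar\kappa : S^1 \to S^n$ of $\kappa$ be the map with $\bar\kappa(\sigma_1(t)) = \sigma_n(\kappa(t))$ for $t \in \mathbb{R}$ that takes the north pole to the north pole. Then $\bar\kappa$ is a tame knot: $\bar\kappa$ is a continuous embedding, and there are a polygonal knot $\beta : S^1 \to S^n$ and orientation-preserving homeomorphisms $f$ of $S^1$ and $g$ of $S^n$ such that $\bar\kappa = g \circ \beta \circ f$. Here a polygonal knot is a continuous embedding $\beta : S^1 \to S^n$ whose image is $\sigma_n(P)$ for a closed polygon $P \subset \mathbb{R}^n$ (the union of the segments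 joining cyclically consecutive points of a finite sequence), and a homeomorphism of $S^k$ is orientation-preserving if it induces the identity on the singular homology group $H_k(S^k;\mathbb{Z})$. -/

import Mathlib

open CategoryTheory

noncomputable section

/-- Euclidean space `ℝⁿ`. -/
abbrev Euc (n : ℕ) : Type := EuclideanSpace ℝ (Fin n)

/-- The unit sphere `Sⁿ ⊂ ℝⁿ⁺¹`. -/
abbrev Sph (n : ℕ) : Type := Metric.sphere (0 : Euc (n + 1)) 1

/-- The north pole `(0, …, 0, 1)` of `Sⁿ`. -/
def northPole (n : ℕ) : Sph n :=
  ⟨EuclideanSpace.single (Fin.last n) 1, by simp⟩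

theorem stereoInv_mem {n : ℕ} (x : Euc n) :
    (WithLp.toLp 2 (Fin.snoc (α := fun _ => ℝ) (fun i => 2 * x i / (‖x‖ ^ 2 + 1))
      ((‖x‖ ^ 2 - 1) / (‖x‖ ^ 2 + 1))) : Euc (n + 1)) ∈ Metric.sphere (0 : Euc (n + 1)) 1 := by
  have h : ‖x‖ ^ 2 + 1 ≠ 0 := by positivity
  have hs : ∑ i : Fin n, (x i) ^ 2 = ‖x‖ ^ 2 := (EuclideanSpace.real_norm_sq_eq x).symm
  rw [mem_sphere_zero_iff_norm, ← sq_eq_sq₀ (norm_nonneg _) zero_le_one,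
    EuclideanSpace.real_norm_sq_eq, Fin.sum_univ_castSucc]
  simp only [Fin.snoc_castSucc, Fin.snoc_last, div_pow, mul_pow, ← Finset.sum_div,
    ← Finset.mul_sum, hs]
  field_simp
  ring

/-- Stereographic projection `ℝⁿ → Sⁿ`,
`x ↦ (2x / (|x|² + 1), (|x|² - 1) / (|x|² + 1))`; its image is `Sⁿ` without the north pole. -/
def stereoInv {n : ℕ} (x : Euc n) : Sph n :=
  ⟨WithLp.toLp 2 (Fin.snoc (α := fun _ => ℝ) (fun i => 2 * x i / (‖x‖ ^ 2 + 1))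
    ((‖x‖ ^ 2 - 1) / (‖x‖ ^ 2 + 1))), stereoInv_mem x⟩

/-- A polynomial knot: a smooth embedding `ℝ → ℝⁿ` whose components are polynomials, that is, a
polynomial map without double points and without critical points. -/
structure IsPolynomialKnot {n : ℕ} (κ : ℝ → Euc n) : Prop where
  polynomial : ∃ p : Fin n → Polynomial ℝ, ∀ t i, κ t i = (p i).eval t
  injective : Function.Injective κ
  deriv_ne_zero : ∀ t, deriv κ t ≠ 0

open Classical in
/-- The completion `κ̄ : S¹ → Sⁿ` of `κ : ℝ → ℝⁿ`. It takes the north pole to the north pole, and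
the point `(2t / (t² + 1), (t² - 1) / (t² + 1))` of `S¹`, whose coordinates `(x, y)` satisfy
`t = x / (1 - y)`, to `stereoInv (κ t)`. -/
def completion {n : ℕ} (κ : ℝ → Euc n) (p : Sph 1) : Sph n :=
  if p = northPole 1 then northPole n
  else stereoInv (κ ((p : Euc 2) 0 / (1 - (p : Euc 2) 1)))

/-- A topological knot: a continuous embedding of `S¹` in `Sⁿ`. -/
def IsTopologicalKnot {n : ℕ} (α : Sph 1 → Sph n) : Prop :=
  Topology.IsEmbedding α

/-- A homeomorphism of `Sᵏ` preserves the orientation if it has degree one, that is, if it induces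
the identity on the singular homology group `H_k(Sᵏ; ℤ)`. -/
def IsOrientationPreserving {k : ℕ} (e : Sph k ≃ₜ Sph k) : Prop :=
  ((AlgebraicTopology.singularHomologyFunctor (ModuleCat.{0} ℤ) k).obj (ModuleCat.of ℤ ℤ)).map
      (TopCat.ofHom (e : C(Sph k, Sph k))) =
    𝟙 (((AlgebraicTopology.singularHomologyFunctor (ModuleCat.{0} ℤ) k).obj
      (ModuleCat.of ℤ ℤ)).obj (TopCat.of (Sph k)))

/-- Topological equivalence of knots: `α₀ = g ∘ α₁ ∘ f` for orientation-preserving homeomorphisms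
`f` of `S¹` and `g` of `Sⁿ`. -/
def TopologicallyEquivalent {n : ℕ} (α₀ α₁ : Sph 1 → Sph n) : Prop :=
  ∃ (f : Sph 1 ≃ₜ Sph 1) (g : Sph n ≃ₜ Sph n),
    IsOrientationPreserving f ∧ IsOrientationPreserving g ∧ α₀ = g ∘ α₁ ∘ f

/-- A polygonal knot: a topological knot that traces a closed polygon in `ℝⁿ ⊂ Sⁿ`, where `ℝⁿ` is
identified with the complement of the north pole by stereographic projection. The polygon is the
union of the segments between cyclically consecutive vertices; as the image of an embedding of the
circle it is automatically a simple closed curve. -/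
def IsPolygonalKnot {n : ℕ} (β : Sph 1 → Sph n) : Prop :=
  IsTopologicalKnot β ∧
    ∃ (k : ℕ) (P : Polygon (Euc n) k), Set.range β = stereoInv '' P.boundary ℝ

/-- A topological knot is tame if it is topologically equivalent to a polygonal knot. -/
def IsTame {n : ℕ} (α : Sph 1 → Sph n) : Prop :=
  IsTopologicalKnot α ∧
    ∃ β : Sph 1 → Sph n, IsPolygonalKnot β ∧ TopologicallyEquivalent α β

end

open Set Filter Topology

/-!
Only the behavior of the knot near infinity can fail to be tame. Some coordinate of the knot is not
constant, and near infinity both ends are graphs over it. If its degree is odd, the ends run in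
opposite directions. If it is even, they run in the same direction; the point of the left end at the
level of a given point of the right end then depends analytically on that point, so by injectivity
another coordinate separates the two ends near infinity, and shears of the levels straighten both.
Scaling the levels in proportion to their height finally makes the ends radial.

All these homeomorphisms of `ℝⁿ` extend to orientation-preserving homeomorphisms of `Sⁿ`. A
half-turn of `Sⁿ`, which is a reflected inversion of `ℝⁿ`, takes the north pole to the origin and
the radial ends to segments from the origin. The remaining regular arc is transverse to these
segments; a fine inscribed polygon is the image of the arc under a homeomorphism that differs from
the identity by a map of small Lipschitz constant and fixes the segments.
-/

/-! ### Orientation-preserving homeomorphisms of the sphere -/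

theorem IsOrientationPreserving.of_homotopic {k : ℕ} {e : Sph k ≃ₜ Sph k}
    (h : (e : C(Sph k, Sph k)).Homotopic (ContinuousMap.id _)) : IsOrientationPreserving e := by
  obtain ⟨H⟩ := h
  have H' : TopCat.Homotopy (TopCat.ofHom (e : C(Sph k, Sph k))) (𝟙 (TopCat.of (Sph k))) := H
  have := H'.congr_homologyMap_singularChainComplexFunctor
    (C := ModuleCat.{0} ℤ) (ModuleCat.of ℤ ℤ) k
  refine Eq.trans this ?_
  exact ((AlgebraicTopology.singularHomologyFunctor (ModuleCat.{0} ℤ) k).obj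
    (ModuleCat.of ℤ ℤ)).map_id (TopCat.of (Sph k))

theorem IsOrientationPreserving.refl (k : ℕ) :
    IsOrientationPreserving (Homeomorph.refl (Sph k)) :=
  .of_homotopic (ContinuousMap.Homotopic.refl _)

theorem IsOrientationPreserving.trans {k : ℕ} {e f : Sph k ≃ₜ Sph k}
    (he : IsOrientationPreserving e) (hf : IsOrientationPreserving f) :
    IsOrientationPreserving (e.trans f) := by
  unfold IsOrientationPreserving at *
  have : TopCat.ofHom ((e.trans f : Sph k ≃ₜ Sph k) : C(Sph k, Sph k)) =
      TopCat.ofHom (e : C(Sph k, Sph k)) ≫ TopCat.ofHom (f : C(Sph k, Sph k)) := rfl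
  rw [this, Functor.map_comp, he, hf, Category.comp_id]

theorem IsOrientationPreserving.symm {k : ℕ} {e : Sph k ≃ₜ Sph k}
    (he : IsOrientationPreserving e) : IsOrientationPreserving e.symm := by
  unfold IsOrientationPreserving at *
  have : TopCat.ofHom (e : C(Sph k, Sph k)) ≫ TopCat.ofHom (e.symm : C(Sph k, Sph k)) =
      𝟙 (TopCat.of (Sph k)) := by
    ext x
    simp
  have hmap := congrArg (((AlgebraicTopology.singularHomologyFunctor (ModuleCat.{0} ℤ) k).obj
      (ModuleCat.of ℤ ℤ)).map) this
  rwa [Functor.map_comp, he, Category.id_comp, CategoryTheory.Functor.map_id] at hmap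

/-! ### The sphere as a one-point compactification -/

section Stereographic

variable {n : ℕ}

@[simp]
theorem stereoInv_castSucc (x : Euc n) (i : Fin n) :
    (stereoInv x : Euc (n + 1)) i.castSucc = 2 * x i / (‖x‖ ^ 2 + 1) := by
  simp [stereoInv]

@[simp]
theorem stereoInv_last (x : Euc n) :
    (stereoInv x : Euc (n + 1)) (Fin.last n) = (‖x‖ ^ 2 - 1) / (‖x‖ ^ 2 + 1) := by
  simp [stereoInv]

@[simp]
theorem northPole_castSucc (i : Fin n) : (northPole n : Euc (n + 1)) i.castSucc = 0 := by
  simp [northPole]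

@[simp]
theorem northPole_last : (northPole n : Euc (n + 1)) (Fin.last n) = 1 := by
  simp [northPole]

theorem Sph.ext_coord {x y : Sph n} (h : ∀ i : Fin n, (x : Euc (n + 1)) i.castSucc =
    (y : Euc (n + 1)) i.castSucc)
    (hl : (x : Euc (n + 1)) (Fin.last n) = (y : Euc (n + 1)) (Fin.last n)) : x = y := by
  refine Subtype.ext (PiLp.ext fun i => ?_)
  induction i using Fin.lastCases with
  | last => exact hl
  | cast i => exact h i

theorem Sph.sum_sq (y : Sph n) :
    ∑ i : Fin n, (y : Euc (n + 1)) i.castSucc ^ 2 + (y : Euc (n + 1)) (Fin.last n) ^ 2 = 1 := by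
  rw [← Fin.sum_univ_castSucc (fun i => (y : Euc (n + 1)) i ^ 2), ← EuclideanSpace.real_norm_sq_eq,
    mem_sphere_zero_iff_norm.1 y.2, one_pow]

theorem Sph.eq_northPole_iff (y : Sph n) :
    y = northPole n ↔ (y : Euc (n + 1)) (Fin.last n) = 1 := by
  refine ⟨fun h => by rw [h, northPole_last], fun h => Sph.ext_coord (fun i => ?_) (by simp [h])⟩
  have hs := Sph.sum_sq y
  rw [h] at hs
  have h0 : ∑ i : Fin n, (y : Euc (n + 1)) i.castSucc ^ 2 = 0 := by linarith
  rw [Finset.sum_eq_zero_iff_of_nonneg (fun _ _ => sq_nonneg _)] at h0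
  simpa using h0 i (Finset.mem_univ i)

theorem one_sub_stereoInv_last (x : Euc n) :
    1 - (stereoInv x : Euc (n + 1)) (Fin.last n) = 2 / (‖x‖ ^ 2 + 1) := by
  have h : ‖x‖ ^ 2 + 1 ≠ 0 := by positivity
  rw [stereoInv_last]
  field_simp
  ring

theorem stereoInv_ne_northPole (x : Euc n) : stereoInv x ≠ northPole n := by
  rw [Ne, Sph.eq_northPole_iff]
  intro h
  have hlast := one_sub_stereoInv_last x
  rw [h, sub_self] at hlast
  have : (0 : ℝ) < 2 / (‖x‖ ^ 2 + 1) := by positivity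
  linarith

theorem stereoInv_castSucc_div (x : Euc n) (i : Fin n) :
    (stereoInv x : Euc (n + 1)) i.castSucc / (1 - (stereoInv x : Euc (n + 1)) (Fin.last n)) =
      x i := by
  have h : ‖x‖ ^ 2 + 1 ≠ 0 := by positivity
  rw [one_sub_stereoInv_last, stereoInv_castSucc]
  field_simp

theorem stereoInv_injective : Function.Injective (stereoInv (n := n)) := by
  intro x y h
  ext i
  rw [← stereoInv_castSucc_div x i, h, stereoInv_castSucc_div]

theorem exists_stereoInv_eq {y : Sph n} (hy : y ≠ northPole n) : ∃ x, stereoInv x = y := by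
  have hl : 1 - (y : Euc (n + 1)) (Fin.last n) ≠ 0 := by
    intro h
    exact hy ((Sph.eq_northPole_iff y).2 (by linarith))
  have hs := Sph.sum_sq y
  set l := (y : Euc (n + 1)) (Fin.last n)
  let x : Euc n := WithLp.toLp 2 fun i => (y : Euc (n + 1)) i.castSucc / (1 - l)
  have hx : ‖x‖ ^ 2 = (1 + l) / (1 - l) := by
    rw [EuclideanSpace.real_norm_sq_eq]
    simp only [x, div_pow, ← Finset.sum_div]
    rw [show ∑ i : Fin n, (y : Euc (n + 1)) i.castSucc ^ 2 = (1 - l) * (1 + l) by linarith]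
    field_simp
  have hx1 : ‖x‖ ^ 2 + 1 = 2 / (1 - l) := by
    rw [hx]
    field_simp
    ring
  refine ⟨x, Sph.ext_coord (fun i => ?_) ?_⟩
  · rw [stereoInv_castSucc, hx1]
    simp only [x]
    field_simp
  · rw [stereoInv_last, hx1, hx]
    field_simp
    ring

theorem continuous_stereoInv : Continuous (stereoInv (n := n)) := by
  refine Continuous.subtype_mk ?_ _
  refine (PiLp.continuous_toLp 2 _).comp (continuous_pi fun i => ?_)
  have h : ∀ x : Euc n, ‖x‖ ^ 2 + 1 ≠ 0 := fun x => by positivity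
  induction i using Fin.lastCases with
  | last =>
    simp only [Fin.snoc_last]
    exact Continuous.div (by fun_prop) (by fun_prop) h
  | cast i =>
    simp only [Fin.snoc_castSucc]
    exact Continuous.div (by fun_prop) (by fun_prop) h

theorem dist_stereoInv_northPole_sq (x : Euc n) :
    dist (stereoInv x) (northPole n) ^ 2 = 4 / (‖x‖ ^ 2 + 1) := by
  have h : ‖x‖ ^ 2 + 1 ≠ 0 := by positivity
  have hs : ∑ i : Fin n, (x i) ^ 2 = ‖x‖ ^ 2 := (EuclideanSpace.real_norm_sq_eq x).symm
  rw [Subtype.dist_eq, dist_eq_norm, EuclideanSpace.real_norm_sq_eq, Fin.sum_univ_castSucc]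
  simp only [PiLp.sub_apply, stereoInv_castSucc, stereoInv_last, northPole_castSucc,
    northPole_last, sub_zero, div_pow, mul_pow, ← Finset.sum_div, ← Finset.mul_sum, hs]
  field_simp
  ring

theorem tendsto_stereoInv_cocompact :
    Tendsto (stereoInv (n := n)) (cocompact (Euc n)) (𝓝 (northPole n)) := by
  rw [tendsto_iff_dist_tendsto_zero]
  have hnorm : Tendsto (fun x : Euc n => ‖x‖ ^ 2 + 1) (cocompact (Euc n)) atTop :=
    tendsto_atTop_add_const_right _ _
      ((tendsto_pow_atTop two_ne_zero).comp tendsto_norm_cocompact_atTop)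
  have hsq : Tendsto (fun x : Euc n => dist (stereoInv x) (northPole n) ^ 2) (cocompact (Euc n))
      (𝓝 0) := by
    simp_rw [dist_stereoInv_northPole_sq]
    exact hnorm.const_div_atTop 4
  have hdist := hsq.sqrt
  simpa [Real.sqrt_sq dist_nonneg] using hdist

theorem bijective_elim_northPole_stereoInv :
    Function.Bijective fun p : OnePoint (Euc n) => p.elim (northPole n) stereoInv := by
  constructor
  · intro p q h
    induction p using OnePoint.rec <;> induction q using OnePoint.rec
    · rfl
    · exact absurd h.symm (stereoInv_ne_northPole _)
    · exact absurd h (stereoInv_ne_northPole _)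
    · exact congrArg _ (stereoInv_injective h)
  · intro y
    by_cases hy : y = northPole n
    · exact ⟨OnePoint.infty, hy.symm⟩
    · obtain ⟨x, hx⟩ := exists_stereoInv_eq hy
      exact ⟨x, hx⟩

theorem continuous_elim_northPole_stereoInv :
    Continuous fun p : OnePoint (Euc n) => p.elim (northPole n) stereoInv := by
  refine (OnePoint.continuous_iff _).2 ⟨?_, continuous_stereoInv⟩
  rw [coclosedCompact_eq_cocompact]
  exact tendsto_stereoInv_cocompact

/-- Stereographic projection as a homeomorphism `ℝⁿ ∪ {∞} ≃ Sⁿ`. -/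
noncomputable def stereoHomeo (n : ℕ) : OnePoint (Euc n) ≃ₜ Sph n :=
  Continuous.homeoOfEquivCompactToT2
    (f := Equiv.ofBijective _ bijective_elim_northPole_stereoInv)
    continuous_elim_northPole_stereoInv

@[simp]
theorem stereoHomeo_coe (x : Euc n) : stereoHomeo n (x : OnePoint (Euc n)) = stereoInv x := rfl

@[simp]
theorem stereoHomeo_infty : stereoHomeo n OnePoint.infty = northPole n := rfl

end Stereographic

/-! ### Extending homeomorphisms of Euclidean space to the sphere -/

section Extension

variable {n : ℕ}

/-- The homeomorphism `h` of `ℝⁿ` extends to an orientation-preserving homeomorphism of `Sⁿ` that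
fixes the north pole. -/
def ExtendsOriented (h : Euc n ≃ₜ Euc n) : Prop :=
  ∃ g : Sph n ≃ₜ Sph n, IsOrientationPreserving g ∧ g (northPole n) = northPole n ∧
    ∀ x, g (stereoInv x) = stereoInv (h x)

theorem ExtendsOriented.trans {h k : Euc n ≃ₜ Euc n} (hh : ExtendsOriented h)
    (hk : ExtendsOriented k) : ExtendsOriented (h.trans k) := by
  obtain ⟨g, hg, hgn, hgx⟩ := hh
  obtain ⟨f, hf, hfn, hfx⟩ := hk
  exact ⟨g.trans f, hg.trans hf, by simp [hgn, hfn], fun x => by simp [hgx, hfx]⟩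

theorem continuous_onePointMap_of_tendsto_cocompact {I X Y : Type*} [TopologicalSpace I]
    [TopologicalSpace X] [T2Space X] [TopologicalSpace Y] {F : I × X → Y} (hF : Continuous F)
    (hp : Tendsto F (cocompact (I × X)) (cocompact Y)) :
    Continuous fun q : I × OnePoint X => OnePoint.map (fun x => F (q.1, x)) q.2 := by
  rw [continuous_iff_continuousAt]
  rintro ⟨s, p⟩
  induction p using OnePoint.rec with
  | infty =>
    rw [ContinuousAt, OnePoint.map_infty, OnePoint.hasBasis_nhds_infty.tendsto_right_iff]
    rintro K ⟨-, hK⟩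
    obtain ⟨L, hL, hLK⟩ := mem_cocompact.1 (hp hK.compl_mem_cocompact)
    have hL' : IsCompact (Prod.snd '' L) := hL.image continuous_snd
    have hmem : ∀ᶠ q : I × OnePoint X in 𝓝 (s, OnePoint.infty),
        q.2 ∈ (↑) '' (Prod.snd '' L)ᶜ ∪ {OnePoint.infty} :=
      continuous_snd.continuousAt.eventually_mem
        (OnePoint.hasBasis_nhds_infty.mem_of_mem ⟨hL'.isClosed, hL'⟩)
    filter_upwards [hmem]
    rintro ⟨u, q⟩ (⟨x, hx, rfl⟩ | rfl)
    · exact Or.inl ⟨F (u, x), hLK fun h => hx ⟨(u, x), h, rfl⟩, rfl⟩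
    · exact Or.inr rfl
  | coe x =>
    have he : IsOpenEmbedding (Prod.map id ((↑) : X → OnePoint X) : I × X → I × OnePoint X) :=
      IsOpenEmbedding.id.prodMap OnePoint.isOpenEmbedding_coe
    have : ((s, (x : OnePoint X)) : I × OnePoint X) = Prod.map id (↑) (s, x) := rfl
    rw [this, ← he.continuousAt_iff]
    exact (OnePoint.continuous_coe.comp hF).continuousAt

theorem ExtendsOriented.of_proper_homotopy (h : Euc n ≃ₜ Euc n)
    (F : unitInterval × Euc n → Euc n) (hF : Continuous F)
    (hp : Tendsto F (cocompact (unitInterval × Euc n)) (cocompact (Euc n)))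
    (h0 : ∀ x, F (0, x) = x) (h1 : ∀ x, F (1, x) = h x) : ExtendsOriented h := by
  refine ⟨((stereoHomeo n).symm.trans h.onePointCongr).trans (stereoHomeo n), ?_, ?_, ?_⟩
  · refine .of_homotopic (ContinuousMap.Homotopic.symm ⟨⟨⟨fun q => stereoHomeo n
      (OnePoint.map (fun x => F (q.1, x)) ((stereoHomeo n).symm q.2)), ?_⟩, ?_, ?_⟩⟩)
    · exact (stereoHomeo n).continuous.comp
        ((continuous_onePointMap_of_tendsto_cocompact hF hp).comp
          (continuous_fst.prodMk ((stereoHomeo n).symm.continuous.comp continuous_snd)))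
    · intro y
      have : (fun x => F (0, x)) = id := funext h0
      simp [this]
    · intro y
      have : (fun x => F (1, x)) = h := funext h1
      simp only [this]
      rfl
  · have : (stereoHomeo n).symm (northPole n) = OnePoint.infty := by
      rw [Homeomorph.symm_apply_eq, stereoHomeo_infty]
    simp only [Homeomorph.trans_apply, this]
    rfl
  · intro x
    have : (stereoHomeo n).symm (stereoInv x) = (x : OnePoint (Euc n)) := by
      rw [Homeomorph.symm_apply_eq, stereoHomeo_coe]
    simp only [Homeomorph.trans_apply, this]
    rfl

theorem exists_extendsOriented_of_isotopy (F G : unitInterval × Euc n → Euc n)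
    (hF : Continuous F) (hG : Continuous G) (hGF : ∀ s x, G (s, F (s, x)) = x)
    (hFG : ∀ x, F (1, G (1, x)) = x) (h0 : ∀ x, F (0, x) = x) :
    ∃ h : Euc n ≃ₜ Euc n, ExtendsOriented h ∧ ∀ x, h x = F (1, x) := by
  let h : Euc n ≃ₜ Euc n :=
    { toFun := fun x => F (1, x)
      invFun := fun x => G (1, x)
      left_inv := fun x => hGF 1 x
      right_inv := fun x => hFG x
      continuous_toFun := hF.comp (by fun_prop)
      continuous_invFun := hG.comp (by fun_prop) }
  refine ⟨h, .of_proper_homotopy h F hF ?_ h0 (fun _ => rfl), fun _ => rfl⟩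
  rw [hasBasis_cocompact.tendsto_right_iff]
  intro K hK
  refine mem_cocompact.2 ⟨univ ×ˢ (G '' (univ ×ˢ K)),
    isCompact_univ.prod ((isCompact_univ.prod hK).image hG), ?_⟩
  rintro ⟨s, x⟩ hx hF
  exact hx ⟨mem_univ _, (s, F (s, x)), ⟨mem_univ _, hF⟩, hGF s x⟩

theorem tendsto_add_smul_cocompact {E : Type*} [NormedAddCommGroup E] [NormedSpace ℝ E]
    [ProperSpace E] {v : E → E} {c : NNReal} (hv : LipschitzWith c v) (hc : c < 1) :
    Tendsto (fun q : unitInterval × E => q.2 + (q.1 : ℝ) • v q.2) (cocompact _) (cocompact _) := by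
  have hc' : (0 : ℝ) < 1 - c := sub_pos.2 (by exact_mod_cast hc)
  have hbound : ∀ q : unitInterval × E, (1 - c) * ‖q.2‖ - ‖v 0‖ ≤ ‖q.2 + (q.1 : ℝ) • v q.2‖ := by
    rintro ⟨s, x⟩
    have hvx : ‖v x‖ ≤ c * ‖x‖ + ‖v 0‖ := by
      have := hv.norm_sub_le x 0
      rw [sub_zero] at this
      linarith [norm_le_norm_add_norm_sub' (v x) (v 0)]
    have hsv : ‖(s : ℝ) • v x‖ ≤ ‖v x‖ := by
      rw [norm_smul, Real.norm_of_nonneg s.2.1]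
      exact mul_le_of_le_one_left (norm_nonneg _) s.2.2
    have htri := norm_sub_le (x + (s : ℝ) • v x) ((s : ℝ) • v x)
    rw [add_sub_cancel_right] at htri
    dsimp only
    linarith
  have hsnd : Tendsto (fun q : unitInterval × E => q.2) (cocompact _) (cocompact _) :=
    (isProperMap_iff_tendsto_cocompact.1 isProperMap_snd_of_compactSpace).2
  rw [← Metric.cobounded_eq_cocompact (α := E), ← tendsto_norm_atTop_iff_cobounded]
  refine tendsto_atTop_mono hbound (tendsto_atTop_add_const_right _ _ ?_)
  exact (tendsto_norm_cocompact_atTop.comp hsnd).const_mul_atTop hc'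

theorem exists_extendsOriented_of_lipschitz {v : Euc n → Euc n} {c : NNReal}
    (hv : LipschitzWith c v) (hc : c < 1) :
    ∃ h : Euc n ≃ₜ Euc n, ExtendsOriented h ∧ ∀ x, h x = x + v x := by
  have happrox : ApproximatesLinearOn (fun x => x + v x)
      (ContinuousLinearEquiv.refl ℝ (Euc n) : Euc n →L[ℝ] Euc n) univ c := by
    apply LipschitzOnWith.approximatesLinearOn
    rw [lipschitzOnWith_univ]
    rwa [show (fun x => x + v x) - ⇑(ContinuousLinearEquiv.refl ℝ (Euc n) : Euc n →L[ℝ] Euc n) = v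
      by ext x; simp]
  have hc' : Subsingleton (Euc n) ∨ c < ‖((ContinuousLinearEquiv.refl ℝ (Euc n)).symm :
      Euc n →L[ℝ] Euc n)‖₊⁻¹ := by
    rcases subsingleton_or_nontrivial (Euc n) with h | h
    · exact Or.inl h
    have : ‖((ContinuousLinearEquiv.refl ℝ (Euc n)).symm : Euc n →L[ℝ] Euc n)‖₊ = 1 := by
      ext
      simp
    exact Or.inr (by rwa [this, inv_one])
  have := hv.continuous
  exact ⟨happrox.toHomeomorph _ hc', .of_proper_homotopy _ (fun q => q.2 + (q.1 : ℝ) • v q.2)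
    (by fun_prop) (tendsto_add_smul_cocompact hv hc) (by simp)
    (fun x => by rw [Icc.coe_one, one_smul]; rfl), fun _ => rfl⟩

theorem exists_extendsOriented_of_lipschitz_family {ι : Type*} (P Γ : ι → Euc n) (c : NNReal)
    (hc : lipschitzExtensionConstant (Euc n) * c < 1)
    (h : ∀ i j, ‖(Γ i - P i) - (Γ j - P j)‖ ≤ c * ‖P i - P j‖) :
    ∃ e : Euc n ≃ₜ Euc n, ExtendsOriented e ∧ ∀ i, e (P i) = Γ i := by
  classical
  let u : Euc n → Euc n := fun x =>
    if hx : ∃ i, P i = x then Γ hx.choose - P hx.choose else 0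
  have hu : ∀ i, u (P i) = Γ i - P i := by
    intro i
    have hx : ∃ j, P j = P i := ⟨i, rfl⟩
    have hsmul := h hx.choose i
    rw [hx.choose_spec, sub_self, norm_zero, mul_zero, norm_le_zero_iff, sub_eq_zero] at hsmul
    simp only [u, dif_pos hx]
    rw [hx.choose_spec, hsmul]
  have hL : LipschitzOnWith c u (range P) := by
    rw [lipschitzOnWith_iff_norm_sub_le]
    rintro _ ⟨i, rfl⟩ _ ⟨j, rfl⟩
    rw [hu, hu]
    exact h i j
  obtain ⟨v, hv, hvu⟩ := hL.extend_finite_dimension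
  obtain ⟨e, he, hev⟩ := exists_extendsOriented_of_lipschitz hv hc
  refine ⟨e, he, fun i => ?_⟩
  rw [hev, ← hvu (mem_range_self i), hu, add_sub_cancel]

end Extension

/-! ### Half-turns of the sphere -/

section PlaneRotation

open scoped RealInnerProductSpace

variable {E : Type*} [NormedAddCommGroup E] [InnerProductSpace ℝ E] {u v : E}

/-- The rotation by the angle `θ` in the oriented plane with orthonormal basis `u`, `v`; it fixes
the orthogonal complement of the plane. -/
noncomputable def planeRotation (u v : E) (θ : ℝ) (x : E) : E :=
  x + ((Real.cos θ - 1) * ⟪u, x⟫ - Real.sin θ * ⟪v, x⟫) • u +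
    (Real.sin θ * ⟪u, x⟫ + (Real.cos θ - 1) * ⟪v, x⟫) • v

theorem continuous_planeRotation (u v : E) :
    Continuous fun q : ℝ × E => planeRotation u v q.1 q.2 := by
  unfold planeRotation
  fun_prop

theorem planeRotation_zero (u v x : E) : planeRotation u v 0 x = x := by
  simp [planeRotation]

theorem planeRotation_pi (u v x : E) :
    planeRotation u v Real.pi x = x - (2 * ⟪u, x⟫) • u - (2 * ⟪v, x⟫) • v := by
  simp only [planeRotation, Real.cos_pi, Real.sin_pi]
  module

theorem norm_planeRotation (hu : ‖u‖ = 1) (hv : ‖v‖ = 1) (huv : ⟪u, v⟫ = 0) (θ : ℝ) (x : E) :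
    ‖planeRotation u v θ x‖ = ‖x‖ := by
  have huu : ⟪u, u⟫ = 1 := by rw [real_inner_self_eq_norm_sq, hu, one_pow]
  have hvv : ⟪v, v⟫ = 1 := by rw [real_inner_self_eq_norm_sq, hv, one_pow]
  rw [← sq_eq_sq₀ (norm_nonneg _) (norm_nonneg _), ← real_inner_self_eq_norm_sq,
    ← real_inner_self_eq_norm_sq, planeRotation]
  simp only [inner_add_left, inner_add_right, real_inner_smul_left, real_inner_smul_right,
    huu, hvv, huv, real_inner_comm u, real_inner_comm v x]
  linear_combination (⟪u, x⟫ ^ 2 + ⟪v, x⟫ ^ 2) * Real.cos_sq_add_sin_sq θ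

theorem planeRotation_pi_involutive (hu : ‖u‖ = 1) (hv : ‖v‖ = 1) (huv : ⟪u, v⟫ = 0) :
    Function.Involutive (planeRotation u v Real.pi) := by
  intro x
  have huu : ⟪u, u⟫ = 1 := by rw [real_inner_self_eq_norm_sq, hu, one_pow]
  have hvv : ⟪v, v⟫ = 1 := by rw [real_inner_self_eq_norm_sq, hv, one_pow]
  have hvu : ⟪v, u⟫ = 0 := by rw [real_inner_comm, huv]
  simp only [planeRotation_pi, inner_sub_right, real_inner_smul_right, huu, hvv, huv, hvu]
  module

end PlaneRotation

section HalfTurn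

open scoped RealInnerProductSpace

variable {n : ℕ}

theorem inner_single_castSucc_single_last (i : Fin n) :
    ⟪EuclideanSpace.single i.castSucc (1 : ℝ), EuclideanSpace.single (Fin.last n) (1 : ℝ)⟫ = 0 := by
  rw [EuclideanSpace.inner_single_left]
  simp [(Fin.castSucc_lt_last i).ne]

theorem planeRotation_mem_sphere (i : Fin n) (θ : ℝ) (y : Sph n) :
    planeRotation (EuclideanSpace.single i.castSucc 1) (EuclideanSpace.single (Fin.last n) 1) θ
      (y : Euc (n + 1)) ∈ Metric.sphere (0 : Euc (n + 1)) 1 := by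
  rw [mem_sphere_zero_iff_norm, norm_planeRotation (by simp) (by simp)
    (inner_single_castSucc_single_last i), mem_sphere_zero_iff_norm.1 y.2]

/-- The half-turn of `Sⁿ` in the plane of the `i`-th and the last coordinate. -/
noncomputable def halfTurn (i : Fin n) : Sph n ≃ₜ Sph n where
  toFun y := ⟨_, planeRotation_mem_sphere i Real.pi y⟩
  invFun y := ⟨_, planeRotation_mem_sphere i Real.pi y⟩
  left_inv y := Subtype.ext (planeRotation_pi_involutive (by simp) (by simp)
    (inner_single_castSucc_single_last i) y)
  right_inv y := Subtype.ext (planeRotation_pi_involutive (by simp) (by simp)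
    (inner_single_castSucc_single_last i) y)
  continuous_toFun := ((continuous_planeRotation _ _).comp
    (continuous_const.prodMk continuous_subtype_val)).subtype_mk _
  continuous_invFun := ((continuous_planeRotation _ _).comp
    (continuous_const.prodMk continuous_subtype_val)).subtype_mk _

theorem isOrientationPreserving_halfTurn (i : Fin n) : IsOrientationPreserving (halfTurn i) := by
  refine .of_homotopic (ContinuousMap.Homotopic.symm ⟨⟨⟨fun q =>
    ⟨_, planeRotation_mem_sphere i (q.1 * Real.pi) q.2⟩, ?_⟩, fun y => ?_, fun y => ?_⟩⟩)
  · exact ((continuous_planeRotation _ _).comp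
      (Continuous.prodMk (by fun_prop) (by fun_prop))).subtype_mk _
  · exact Subtype.ext (by simp [planeRotation_zero])
  · exact Subtype.ext (by simp only [Icc.coe_one, one_mul]; rfl)

theorem halfTurn_apply (i : Fin n) (y : Sph n) (k : Fin (n + 1)) :
    (halfTurn i y : Euc (n + 1)) k = if k = i.castSucc ∨ k = Fin.last n
      then -(y : Euc (n + 1)) k else (y : Euc (n + 1)) k := by
  have hi : i.castSucc ≠ Fin.last n := (Fin.castSucc_lt_last i).ne
  change planeRotation _ _ Real.pi (y : Euc (n + 1)) k = _
  rw [planeRotation_pi]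
  simp only [PiLp.sub_apply, PiLp.smul_apply, smul_eq_mul, PiLp.single_apply,
    EuclideanSpace.inner_single_left]
  rcases eq_or_ne k i.castSucc with rfl | hk
  · simp [hi]
    ring
  · split_ifs <;> simp_all
    ring

theorem halfTurn_northPole (i : Fin n) : halfTurn i (northPole n) = stereoInv 0 := by
  refine Sph.ext_coord (fun k => ?_) ?_ <;> rw [halfTurn_apply] <;> simp

/-- The inversion in the unit sphere followed by the reflection in the hyperplane `x i = 0`. It is
the half-turn of `Sⁿ` in the stereographic chart. -/
noncomputable def reflectedInversion (i : Fin n) (x : Euc n) : Euc n :=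
  (ℝ ∙ EuclideanSpace.single i (1 : ℝ))ᗮ.reflection (EuclideanGeometry.inversion 0 1 x)

theorem reflectedInversion_apply (i : Fin n) (x : Euc n) (k : Fin n) :
    reflectedInversion i x k = if k = i then -(x k / ‖x‖ ^ 2) else x k / ‖x‖ ^ 2 := by
  rw [reflectedInversion, Submodule.reflection_orthogonal_apply,
    Submodule.reflection_singleton_apply]
  simp only [EuclideanGeometry.inversion_def, PiLp.neg_apply, PiLp.sub_apply, PiLp.smul_apply,
    smul_eq_mul, PiLp.single_apply, EuclideanSpace.inner_single_left]
  split_ifs <;> simp_all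
  all_goals ring

theorem norm_reflectedInversion (i : Fin n) (x : Euc n) : ‖reflectedInversion i x‖ = ‖x‖⁻¹ := by
  rw [reflectedInversion, LinearIsometryEquiv.norm_map, ← dist_zero_right,
    EuclideanGeometry.dist_inversion_center, dist_zero_right, one_pow, one_div]

theorem reflectedInversion_ne_zero (i : Fin n) {x : Euc n} (hx : x ≠ 0) :
    reflectedInversion i x ≠ 0 := by
  rw [← norm_ne_zero_iff, norm_reflectedInversion]
  exact inv_ne_zero (norm_ne_zero_iff.2 hx)

theorem halfTurn_stereoInv (i : Fin n) {x : Euc n} (hx : x ≠ 0) :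
    halfTurn i (stereoInv x) = stereoInv (reflectedInversion i x) := by
  have hx0 : ‖x‖ ≠ 0 := norm_ne_zero_iff.2 hx
  refine Sph.ext_coord (fun k => ?_) ?_
  · simp only [halfTurn_apply, stereoInv_castSucc, norm_reflectedInversion,
      reflectedInversion_apply, Fin.castSucc_inj, (Fin.castSucc_lt_last k).ne, or_false]
    split_ifs <;> field_simp <;> ring
  · simp only [halfTurn_apply, stereoInv_last, norm_reflectedInversion, or_true, if_true]
    field_simp
    ring

theorem dist_reflectedInversion (i : Fin n) {x y : Euc n} (hx : x ≠ 0) (hy : y ≠ 0) :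
    dist (reflectedInversion i x) (reflectedInversion i y) = dist x y / (‖x‖ * ‖y‖) := by
  rw [reflectedInversion, reflectedInversion, LinearIsometryEquiv.dist_map,
    EuclideanGeometry.dist_inversion_inversion hx hy, dist_zero_right, dist_zero_right, one_pow]
  ring

theorem contDiffAt_reflectedInversion (i : Fin n) {x : Euc n} (hx : x ≠ 0) :
    ContDiffAt ℝ 1 (reflectedInversion i) x :=
  (LinearIsometryEquiv.contDiff _).contDiffAt.comp x
    (ContDiffAt.inversion contDiffAt_const contDiffAt_const contDiffAt_id hx)

theorem reflectedInversion_involutive (i : Fin n) :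
    Function.Involutive (reflectedInversion i) := by
  intro x
  ext k
  rcases eq_or_ne x 0 with rfl | hx
  · simp [reflectedInversion_apply]
  have hx0 : ‖x‖ ≠ 0 := norm_ne_zero_iff.2 hx
  simp only [reflectedInversion_apply, norm_reflectedInversion]
  split_ifs <;> field_simp

theorem reflectedInversion_smul (i : Fin n) (r : ℝ) (x : Euc n) :
    reflectedInversion i (r • x) = r⁻¹ • reflectedInversion i x := by
  ext k
  simp only [reflectedInversion_apply, PiLp.smul_apply, smul_eq_mul, norm_smul, mul_pow,
    Real.norm_eq_abs, sq_abs, mul_ite]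
  rcases eq_or_ne r 0 with rfl | hr
  · simp
  split_ifs <;> field_simp

end HalfTurn

/-! ### Regular arcs -/

section RegularArc

variable {E : Type*} [NormedAddCommGroup E] [NormedSpace ℝ E] {γ : ℝ → E} {a b : ℝ}

/-- On `[a, b]` the curve `γ` is a simple, continuously differentiable arc without critical
points. Differentiability is required in a neighborhood of `[a, b]`, so that `deriv γ` has its
usual meaning at the end points. -/
structure IsRegularArc (γ : ℝ → E) (a b : ℝ) : Prop where
  contDiffAt : ∀ t ∈ Icc a b, ContDiffAt ℝ 1 γ t
  injOn : InjOn γ (Icc a b)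
  deriv_ne_zero : ∀ t ∈ Icc a b, deriv γ t ≠ 0

theorem IsRegularArc.continuousOn (h : IsRegularArc γ a b) : ContinuousOn γ (Icc a b) :=
  fun t ht => (h.contDiffAt t ht).continuousAt.continuousWithinAt

theorem continuousOn_deriv_of_contDiffAt {s : Set ℝ} (h : ∀ t ∈ s, ContDiffAt ℝ 1 γ t) :
    ContinuousOn (deriv γ) s := by
  intro t ht
  change ContinuousWithinAt (fun t => fderiv ℝ γ t 1) s t
  exact (((h t ht).continuousAt_fderiv one_ne_zero).clm_apply
    continuousAt_const).continuousWithinAt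

theorem exists_uniform_deriv_bound (h : ∀ t ∈ Icc a b, ContDiffAt ℝ 1 γ t) {ε : ℝ} (hε : 0 < ε) :
    ∃ η > 0, ∀ u ∈ Icc a b, ∀ w ∈ Icc a b, |w - u| ≤ η → ∀ s ∈ uIcc u w, ∀ t ∈ uIcc u w,
      ‖γ t - γ s - (t - s) • deriv γ u‖ ≤ ε * |t - s| := by
  have huc := isCompact_Icc.uniformContinuousOn_of_continuous (continuousOn_deriv_of_contDiffAt h)
  rw [Metric.uniformContinuousOn_iff_le] at huc
  obtain ⟨η, hη, huη⟩ := huc ε hε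
  refine ⟨η, hη, fun u hu w hw huw s hs t ht => ?_⟩
  have hsub : uIcc u w ⊆ Icc a b := uIcc_subset_Icc hu hw
  have hderiv : ∀ x ∈ uIcc u w, HasDerivWithinAt (fun x => γ x - x • deriv γ u)
      (deriv γ x - (1 : ℝ) • deriv γ u) (uIcc u w) x := fun x hx =>
    ((((h x (hsub hx)).differentiableAt one_ne_zero).hasDerivAt).sub
      ((hasDerivAt_id x).smul_const (deriv γ u))).hasDerivWithinAt
  have hbound : ∀ x ∈ uIcc u w, ‖deriv γ x - (1 : ℝ) • deriv γ u‖ ≤ ε := by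
    intro x hx
    rw [one_smul, ← dist_eq_norm]
    exact huη x (hsub hx) u hu ((abs_sub_left_of_mem_uIcc hx).trans huw)
  have hmvt := (convex_uIcc u w).norm_image_sub_le_of_norm_hasDerivWithin_le hderiv hbound hs ht
  rw [Real.norm_eq_abs] at hmvt
  convert hmvt using 2
  module

theorem exists_pos_le_dist_of_injOn {X Y : Type*} [PseudoMetricSpace X] [MetricSpace Y] {f : X → Y}
    {K : Set X} (hK : IsCompact K) (hf : ContinuousOn f K) (hinj : InjOn f K) {η : ℝ}
    (hη : 0 < η) :
    ∃ d > 0, ∀ s ∈ K, ∀ t ∈ K, η ≤ dist s t → d ≤ dist (f s) (f t) := by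
  let A : Set (X × X) := (K ×ˢ K) ∩ {q | η ≤ dist q.1 q.2}
  have hA : IsCompact A := (hK.prod hK).inter_right
    (isClosed_le continuous_const (by fun_prop))
  have hcont : ContinuousOn (fun q : X × X => dist (f q.1) (f q.2)) A :=
    continuous_dist.comp_continuousOn
      ((hf.comp continuous_fst.continuousOn fun q (hq : q ∈ A) => hq.1.1).prodMk
        (hf.comp continuous_snd.continuousOn fun q (hq : q ∈ A) => hq.1.2))
  rcases A.eq_empty_or_nonempty with hAe | hAne
  · exact ⟨1, one_pos, fun s hs t ht hst => (hAe.subset ⟨⟨hs, ht⟩, hst⟩ : (s, t) ∈ ∅).elim⟩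
  · obtain ⟨q, hq, hqmin⟩ := hA.exists_isMinOn hAne hcont
    refine ⟨_, dist_pos.2 fun h => ?_, fun s hs t ht hst => hqmin (⟨⟨hs, ht⟩, hst⟩ : (s, t) ∈ A)⟩
    have hq' : η ≤ dist q.1 q.2 := hq.2
    rw [hinj hq.1.1 hq.1.2 h, dist_self] at hq'
    exact hη.not_ge hq'

theorem IsRegularArc.exists_lower_bound_of_near (h : IsRegularArc γ a b) :
    ∃ m > 0, ∃ η > 0, ∀ s ∈ Icc a b, ∀ t ∈ Icc a b, |s - t| ≤ η →
      m * |s - t| ≤ dist (γ s) (γ t) := by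
  rcases (Icc a b).eq_empty_or_nonempty with he | hne
  · exact ⟨1, one_pos, 1, one_pos, by simp [he]⟩
  obtain ⟨t₀, ht₀, hmin⟩ :=
    isCompact_Icc.exists_isMinOn hne (continuousOn_deriv_of_contDiffAt h.contDiffAt).norm
  have hm : 0 < ‖deriv γ t₀‖ / 2 := half_pos (norm_pos_iff.2 (h.deriv_ne_zero t₀ ht₀))
  obtain ⟨η, hη, hu⟩ := exists_uniform_deriv_bound h.contDiffAt hm
  refine ⟨_, hm, η, hη, fun s hs t ht hst => ?_⟩
  have hlin := hu t ht s hs hst t left_mem_uIcc s right_mem_uIcc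
  have hspeed : ‖deriv γ t₀‖ * |s - t| ≤ ‖(s - t) • deriv γ t‖ := by
    rw [norm_smul, Real.norm_eq_abs, mul_comm]
    exact mul_le_mul_of_nonneg_left (hmin ht) (abs_nonneg _)
  have htri := norm_sub_le (γ s - γ t) (γ s - γ t - (s - t) • deriv γ t)
  rw [sub_sub_cancel] at htri
  rw [dist_eq_norm]
  linarith

theorem IsRegularArc.exists_lower_lipschitz_bound (h : IsRegularArc γ a b) :
    ∃ m > 0, ∀ s ∈ Icc a b, ∀ t ∈ Icc a b, m * |s - t| ≤ dist (γ s) (γ t) := by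
  obtain ⟨m, hm, η, hη, hnear⟩ := h.exists_lower_bound_of_near
  obtain ⟨d, hd, hfar⟩ := exists_pos_le_dist_of_injOn isCompact_Icc h.continuousOn h.injOn hη
  refine ⟨min m (d / (|b - a| + 1)), lt_min hm (by positivity), fun s hs t ht => ?_⟩
  rcases le_total (|s - t|) η with hst | hst
  · exact (mul_le_mul_of_nonneg_right (min_le_left _ _) (abs_nonneg _)).trans (hnear s hs t ht hst)
  · have hlen : |s - t| ≤ |b - a| + 1 := by
      linarith [abs_sub_le_of_uIcc_subset_uIcc (uIcc_subset_uIcc (Icc_subset_uIcc hs)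
        (Icc_subset_uIcc ht)), abs_sub_comm s t]
    calc min m (d / (|b - a| + 1)) * |s - t|
        ≤ d / (|b - a| + 1) * (|b - a| + 1) := by
          gcongr
          exact min_le_right _ _
      _ = d := by field_simp
      _ ≤ dist (γ s) (γ t) := hfar s hs t ht hst

end RegularArc

section Transverse

variable {X : Type*} [PseudoMetricSpace X] {γ : ℝ → X} {a b : ℝ}

/-- The points `γ t` of the arc `γ` on `[a, b]` keep a distance to `S` that is at least
proportional to the distance of the parameter `t` to the ends of the interval. -/
def IsTransverseAtEnds (γ : ℝ → X) (a b : ℝ) (S : Set X) : Prop :=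
  ∃ m > 0, ∀ t ∈ Icc a b, ∀ x ∈ S, m * min (t - a) (b - t) ≤ dist (γ t) x

theorem min_sub_nonneg {t : ℝ} (ht : t ∈ Icc a b) : 0 ≤ min (t - a) (b - t) :=
  le_min (sub_nonneg.2 ht.1) (sub_nonneg.2 ht.2)

theorem IsTransverseAtEnds.union {S S' : Set X} (h : IsTransverseAtEnds γ a b S)
    (h' : IsTransverseAtEnds γ a b S') : IsTransverseAtEnds γ a b (S ∪ S') := by
  obtain ⟨m, hm, hS⟩ := h
  obtain ⟨m', hm', hS'⟩ := h'
  refine ⟨min m m', lt_min hm hm', fun t ht x hx => ?_⟩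
  have := min_sub_nonneg ht
  rcases hx with hx | hx
  · exact (mul_le_mul_of_nonneg_right (min_le_left _ _) this).trans (hS t ht x hx)
  · exact (mul_le_mul_of_nonneg_right (min_le_right _ _) this).trans (hS' t ht x hx)

theorem isTransverseAtEnds_singleton {X : Type*} [MetricSpace X] {γ : ℝ → X} {x : X}
    (hγ : ContinuousOn γ (Icc a b)) (hx : ∀ t ∈ Icc a b, γ t ≠ x) :
    IsTransverseAtEnds γ a b {x} := by
  obtain ⟨m, hm, hmx⟩ : ∃ m > 0, ∀ t ∈ Icc a b, m ≤ dist (γ t) x :=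
    isCompact_Icc.exists_forall_le'
      (continuous_id.dist continuous_const |>.comp_continuousOn hγ) fun t ht => dist_pos.2 (hx t ht)
  refine ⟨m / (|b - a| + 1), by positivity, ?_⟩
  rintro t ht _ rfl
  have hmin : min (t - a) (b - t) ≤ |b - a| + 1 :=
    (min_le_left _ _).trans (by linarith [ht.2, le_abs_self (b - a)])
  calc m / (|b - a| + 1) * min (t - a) (b - t) ≤ m / (|b - a| + 1) * (|b - a| + 1) := by gcongr
    _ = m := div_mul_cancel₀ _ (by positivity)
    _ ≤ _ := hmx t ht

end Transverse

/-! ### Inscribed polygons -/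

section Inscribed

variable {a b : ℝ} {N : ℕ}

theorem iUnion_Icc_succ_eq_Icc {p : ℕ → ℝ} (hp : Monotone p) (hN : 0 < N) :
    ⋃ k < N, Icc (p k) (p (k + 1)) = Icc (p 0) (p N) := by
  induction N, hN using Nat.le_induction with
  | base => simp
  | succ N hN ih =>
    rw [biUnion_lt_succ, ih, Icc_union_Icc_eq_Icc (hp (Nat.zero_le N)) (hp N.le_succ)]

theorem norm_sub_le_of_Icc_union {E : Type*} [SeminormedAddCommGroup E] {f : ℝ → E} {c δ : ℝ}
    (hab : ∀ s ∈ Icc a b, ∀ t ∈ Icc a b, ‖f s - f t‖ ≤ δ * |s - t|)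
    (hbc : ∀ s ∈ Icc b c, ∀ t ∈ Icc b c, ‖f s - f t‖ ≤ δ * |s - t|) :
    ∀ s ∈ Icc a c, ∀ t ∈ Icc a c, ‖f s - f t‖ ≤ δ * |s - t| := by
  intro s hs t ht
  wlog hst : s ≤ t generalizing s t
  · rw [norm_sub_rev, abs_sub_comm]
    exact this t ht s hs (le_of_not_ge hst)
  rcases le_total t b with htb | hbt
  · exact hab s ⟨hs.1, hst.trans htb⟩ t ⟨ht.1, htb⟩
  rcases le_total b s with hbs | hsb
  · exact hbc s ⟨hbs, hs.2⟩ t ⟨hbt, ht.2⟩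
  have h₁ := hab s ⟨hs.1, hsb⟩ b ⟨hs.1.trans hsb, le_rfl⟩
  have h₂ := hbc b ⟨le_rfl, hbt.trans ht.2⟩ t ⟨hbt, ht.2⟩
  rw [abs_of_nonpos (by linarith)] at h₁ h₂ ⊢
  have := norm_sub_le_norm_sub_add_norm_sub (f s) (f b) (f t)
  linarith

theorem norm_sub_le_of_partition {E : Type*} [SeminormedAddCommGroup E] {f : ℝ → E} {p : ℕ → ℝ}
    {δ : ℝ}
    (h : ∀ k < N, ∀ s ∈ Icc (p k) (p (k + 1)), ∀ t ∈ Icc (p k) (p (k + 1)),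
      ‖f s - f t‖ ≤ δ * |s - t|) :
    ∀ s ∈ Icc (p 0) (p N), ∀ t ∈ Icc (p 0) (p N), ‖f s - f t‖ ≤ δ * |s - t| := by
  induction N with
  | zero =>
    rw [Icc_self]
    rintro _ rfl _ rfl
    simp
  | succ N ih =>
    exact norm_sub_le_of_Icc_union (ih fun k hk => h k (hk.trans N.lt_succ_self))
      (h N N.lt_succ_self)

theorem norm_le_mul_min_sub {E : Type*} [NormedAddCommGroup E] {f : ℝ → E} {δ : ℝ}
    (ha : f a = 0) (hb : f b = 0)
    (h : ∀ s ∈ Icc a b, ∀ t ∈ Icc a b, ‖f s - f t‖ ≤ δ * |s - t|) (hδ : 0 ≤ δ) {t : ℝ}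
    (ht : t ∈ Icc a b) : ‖f t‖ ≤ δ * min (t - a) (b - t) := by
  have hab := ht.1.trans ht.2
  have hta := h t ht a (left_mem_Icc.2 hab)
  have htb := h t ht b (right_mem_Icc.2 hab)
  rw [ha, sub_zero, abs_of_nonneg (sub_nonneg.2 ht.1)] at hta
  rw [hb, sub_zero, abs_sub_comm, abs_of_nonneg (sub_nonneg.2 ht.2)] at htb
  rw [mul_min_of_nonneg _ _ hδ]
  exact le_min hta htb

/-- The `k`-th point of the partition of `[a, b]` into `N` intervals of equal length. -/
noncomputable def partitionPoint (a b : ℝ) (N k : ℕ) : ℝ := a + k * ((b - a) / N)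

theorem partitionPoint_zero (a b : ℝ) (N : ℕ) : partitionPoint a b N 0 = a := by
  simp [partitionPoint]

theorem partitionPoint_self (a b : ℝ) (hN : 0 < N) : partitionPoint a b N N = b := by
  rw [partitionPoint]
  field_simp
  ring

theorem partitionPoint_succ (a b : ℝ) (N k : ℕ) :
    partitionPoint a b N (k + 1) = partitionPoint a b N k + (b - a) / N := by
  simp only [partitionPoint]
  push_cast
  ring

theorem partitionPoint_strictMono (hab : a < b) (hN : 0 < N) :
    StrictMono (partitionPoint a b N) := by
  refine strictMono_nat_of_lt_succ fun k => ?_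
  rw [partitionPoint_succ]
  exact lt_add_of_pos_right _ (div_pos (sub_pos.2 hab) (Nat.cast_pos.2 hN))

theorem partitionPoint_mem_Icc (hab : a < b) (hN : 0 < N) {k : ℕ} (hk : k ≤ N) :
    partitionPoint a b N k ∈ Icc a b := by
  have hmono := (partitionPoint_strictMono hab hN).monotone
  exact ⟨(partitionPoint_zero a b N).ge.trans (hmono k.zero_le),
    (hmono hk).trans (partitionPoint_self a b hN).le⟩

variable {E : Type*} [NormedAddCommGroup E] [NormedSpace ℝ E] {γ : ℝ → E}

theorem image_chord_eq_segment (γ : ℝ → E) (hab : a ≤ b) :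
    (fun t => γ a + (t - a) • slope γ a b) '' Icc a b = segment ℝ (γ a) (γ b) := by
  rw [← segment_eq_Icc hab, segment_eq_image_lineMap, segment_eq_image_lineMap, image_image]
  refine image_congr fun r _ => ?_
  have hr : (AffineMap.lineMap a b r : ℝ) - a = r * (b - a) := by
    simp [AffineMap.lineMap_apply]
  rw [hr, mul_smul, sub_smul_slope, AffineMap.lineMap_apply, vsub_eq_sub, vadd_eq_add, add_comm]

theorem norm_sub_chord_sub_le {u w ε : ℝ} {D : E} (huw : u < w)
    (h : ∀ s ∈ Icc u w, ∀ t ∈ Icc u w, ‖γ t - γ s - (t - s) • D‖ ≤ ε * |t - s|) {s t : ℝ}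
    (hs : s ∈ Icc u w) (ht : t ∈ Icc u w) :
    ‖(γ s - (γ u + (s - u) • slope γ u w)) - (γ t - (γ u + (t - u) • slope γ u w))‖ ≤
      2 * ε * |s - t| := by
  have hslope : ‖slope γ u w - D‖ ≤ ε := by
    have hchord := h u (left_mem_Icc.2 huw.le) w (right_mem_Icc.2 huw.le)
    rw [← vsub_eq_sub (γ w), ← sub_smul_slope, ← smul_sub, norm_smul, Real.norm_eq_abs,
      mul_comm] at hchord
    exact le_of_mul_le_mul_right hchord (abs_pos.2 (sub_pos.2 huw).ne')
  calc ‖(γ s - (γ u + (s - u) • slope γ u w)) - (γ t - (γ u + (t - u) • slope γ u w))‖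
      = ‖(γ s - γ t - (s - t) • D) - (s - t) • (slope γ u w - D)‖ := by
        congr 1
        module
    _ ≤ ‖γ s - γ t - (s - t) • D‖ + |s - t| * ‖slope γ u w - D‖ := by
        rw [← Real.norm_eq_abs, ← norm_smul]
        exact norm_sub_le _ _
    _ ≤ ε * |s - t| + |s - t| * ε := by
        gcongr
        exact h t ht s hs
    _ = 2 * ε * |s - t| := by ring

/-- The piecewise linear interpolation of `γ` at the points that divide `[a, b]` into `N` intervals
of equal length. -/
noncomputable def inscribedPolygon (γ : ℝ → E) (a b : ℝ) (N : ℕ) (t : ℝ) : E :=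
  let p := partitionPoint a b N
  let k := ⌊(t - a) / ((b - a) / N)⌋₊
  γ (p k) + (t - p k) • slope γ (p k) (p (k + 1))

theorem inscribedPolygon_of_mem_Icc (γ : ℝ → E) (hab : a < b) (hN : 0 < N) {k : ℕ} {t : ℝ}
    (ht : t ∈ Icc (partitionPoint a b N k) (partitionPoint a b N (k + 1))) :
    inscribedPolygon γ a b N t = γ (partitionPoint a b N k) + (t - partitionPoint a b N k) •
      slope γ (partitionPoint a b N k) (partitionPoint a b N (k + 1)) := by
  have hh : 0 < (b - a) / N := div_pos (sub_pos.2 hab) (Nat.cast_pos.2 hN)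
  rcases ht.2.eq_or_lt with rfl | htk
  · have hfloor : ⌊(partitionPoint a b N (k + 1) - a) / ((b - a) / N)⌋₊ = k + 1 := by
      rw [partitionPoint, add_sub_cancel_left, mul_div_cancel_right₀ _ hh.ne', Nat.floor_natCast]
    simp only [inscribedPolygon, hfloor, sub_self, zero_smul, add_zero]
    rw [sub_smul_slope, vsub_eq_sub, add_sub_cancel]
  · have hfloor : ⌊(t - a) / ((b - a) / N)⌋₊ = k := by
      have hlow := ht.1
      simp only [partitionPoint] at hlow htk
      push_cast at htk
      have hk : (k : ℝ) ≤ (t - a) / ((b - a) / N) := (le_div_iff₀ hh).2 (by linarith)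
      rw [Nat.floor_eq_iff ((Nat.cast_nonneg k).trans hk)]
      exact ⟨hk, (div_lt_iff₀ hh).2 (by linarith)⟩
    simp only [inscribedPolygon, hfloor]

theorem inscribedPolygon_left (γ : ℝ → E) (hab : a < b) (hN : 0 < N) :
    inscribedPolygon γ a b N a = γ a := by
  have hp := partitionPoint_strictMono hab hN
  have ha : a ∈ Icc (partitionPoint a b N 0) (partitionPoint a b N (0 + 1)) := by
    have := left_mem_Icc.2 (hp zero_lt_one).le
    rwa [partitionPoint_zero] at this ⊢
  rw [inscribedPolygon_of_mem_Icc γ hab hN ha, partitionPoint_zero, sub_self, zero_smul, add_zero]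

theorem inscribedPolygon_right (γ : ℝ → E) (hab : a < b) (hN : 0 < N) :
    inscribedPolygon γ a b N b = γ b := by
  have hp := partitionPoint_strictMono hab hN
  have hb : b ∈ Icc (partitionPoint a b N N) (partitionPoint a b N (N + 1)) := by
    have := left_mem_Icc.2 (hp N.lt_succ_self).le
    rwa [partitionPoint_self a b hN] at this ⊢
  rw [inscribedPolygon_of_mem_Icc γ hab hN hb, partitionPoint_self a b hN, sub_self, zero_smul,
    add_zero]

theorem image_inscribedPolygon (γ : ℝ → E) (hab : a < b) (hN : 0 < N) :
    inscribedPolygon γ a b N '' Icc a b =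
      ⋃ k < N, segment ℝ (γ (partitionPoint a b N k)) (γ (partitionPoint a b N (k + 1))) := by
  have hp := (partitionPoint_strictMono hab hN).monotone
  have hcover := iUnion_Icc_succ_eq_Icc hp hN
  rw [partitionPoint_zero, partitionPoint_self a b hN] at hcover
  rw [← hcover, image_iUnion₂]
  refine iUnion₂_congr fun k _ => ?_
  rw [← image_chord_eq_segment γ (hp k.le_succ)]
  exact image_congr fun t ht => inscribedPolygon_of_mem_Icc γ hab hN ht

theorem exists_inscribedPolygon_lipschitz_sub (hab : a < b)
    (h : ∀ t ∈ Icc a b, ContDiffAt ℝ 1 γ t) {δ : ℝ} (hδ : 0 < δ) :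
    ∃ N > 0, ∀ s ∈ Icc a b, ∀ t ∈ Icc a b,
      ‖(γ s - inscribedPolygon γ a b N s) - (γ t - inscribedPolygon γ a b N t)‖ ≤
        δ * |s - t| := by
  obtain ⟨η, hη, hu⟩ := exists_uniform_deriv_bound h (half_pos hδ)
  obtain ⟨N, hNη⟩ := exists_nat_gt ((b - a) / η)
  have hN : 0 < N := Nat.cast_pos.1 ((div_pos (sub_pos.2 hab) hη).trans hNη)
  have hmesh : (b - a) / N ≤ η := by
    rw [div_lt_iff₀ hη] at hNη
    rw [div_le_iff₀ (Nat.cast_pos.2 hN)]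
    linarith
  have hp := partitionPoint_strictMono hab hN
  refine ⟨N, hN, ?_⟩
  have hpart := norm_sub_le_of_partition (N := N) (p := partitionPoint a b N) (δ := δ)
    (f := fun t => γ t - inscribedPolygon γ a b N t) fun k hk s hs t ht => ?_
  · rwa [partitionPoint_zero, partitionPoint_self a b hN] at hpart
  · have hlt := hp k.lt_succ_self
    have hmem : ∀ x ∈ Icc (partitionPoint a b N k) (partitionPoint a b N (k + 1)),
        x ∈ uIcc (partitionPoint a b N k) (partitionPoint a b N (k + 1)) := Icc_subset_uIcc
    have hlen : |partitionPoint a b N (k + 1) - partitionPoint a b N k| ≤ η := by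
      rwa [partitionPoint_succ, add_sub_cancel_left,
        abs_of_pos (div_pos (sub_pos.2 hab) (Nat.cast_pos.2 hN))]
    have hlin := hu _ (partitionPoint_mem_Icc hab hN hk.le) _ (partitionPoint_mem_Icc hab hN hk)
      hlen
    simp only [inscribedPolygon_of_mem_Icc γ hab hN hs, inscribedPolygon_of_mem_Icc γ hab hN ht]
    refine (norm_sub_chord_sub_le hlt (fun s hs t ht => hlin s (hmem s hs) t (hmem t ht))
      hs ht).trans_eq ?_
    ring

variable {n : ℕ}

theorem exists_extendsOriented_eqOn {α : Type*} {s : Set α} {γ Q : α → Euc n} {S : Set (Euc n)}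
    {c : NNReal} (hc : lipschitzExtensionConstant (Euc n) * c < 1)
    (hγ : ∀ t ∈ s, ∀ u ∈ s, ‖(γ t - Q t) - (γ u - Q u)‖ ≤ c * ‖γ t - γ u‖)
    (hS : ∀ t ∈ s, ∀ x ∈ S, ‖γ t - Q t‖ ≤ c * ‖γ t - x‖) :
    ∃ e : Euc n ≃ₜ Euc n, ExtendsOriented e ∧ (∀ x ∈ S, e x = x) ∧ ∀ t ∈ s, e (γ t) = Q t := by
  let P : s ⊕ S → Euc n := Sum.elim (fun t => γ t) (fun x => x)
  let Γ : s ⊕ S → Euc n := Sum.elim (fun t => Q t) (fun x => x)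
  have hPΓ : ∀ i j, ‖(Γ i - P i) - (Γ j - P j)‖ ≤ c * ‖P i - P j‖ := by
    rintro (⟨t, ht⟩ | ⟨x, hx⟩) (⟨u, hu⟩ | ⟨y, hy⟩)
    · change ‖(Q t - γ t) - (Q u - γ u)‖ ≤ c * ‖γ t - γ u‖
      rw [← norm_neg, neg_sub', neg_sub, neg_sub]
      exact hγ t ht u hu
    · simpa [P, Γ, norm_sub_rev] using hS t ht y hy
    · simpa [P, Γ, norm_sub_rev] using hS u hu x hx
    · simp only [P, Γ, Sum.elim_inr, sub_self, norm_zero]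
      positivity
  obtain ⟨e, he, hmap⟩ := exists_extendsOriented_of_lipschitz_family P Γ c hc hPΓ
  exact ⟨e, he, fun x hx => hmap (.inr ⟨x, hx⟩), fun t ht => hmap (.inl ⟨t, ht⟩)⟩

theorem IsRegularArc.exists_extendsOriented_inscribed {γ : ℝ → Euc n} {S : Set (Euc n)}
    (hγ : IsRegularArc γ a b) (hab : a < b) (hS : IsTransverseAtEnds γ a b S) :
    ∃ N > 0, ∃ e : Euc n ≃ₜ Euc n, ExtendsOriented e ∧ (∀ x ∈ S, e x = x) ∧
      e '' (γ '' Icc a b) =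
        ⋃ k < N, segment ℝ (γ (partitionPoint a b N k)) (γ (partitionPoint a b N (k + 1))) := by
  obtain ⟨m₁, hm₁, hlow⟩ := hγ.exists_lower_lipschitz_bound
  obtain ⟨m₂, hm₂, htr⟩ := hS
  set K := lipschitzExtensionConstant (Euc n)
  let c : NNReal := (K + 1)⁻¹
  have hc : K * c < 1 := by
    rw [← div_eq_mul_inv, div_lt_one (by positivity)]
    exact lt_add_one K
  have hc₀ : 0 < (c : ℝ) := by positivity
  obtain ⟨N, hN, hclose⟩ := exists_inscribedPolygon_lipschitz_sub hab hγ.contDiffAt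
    (mul_pos hc₀ (lt_min hm₁ hm₂))
  let Q := inscribedPolygon γ a b N
  have hends : ∀ t ∈ Icc a b, ∀ x ∈ S, ‖γ t - Q t‖ ≤ c * ‖γ t - x‖ := fun t ht x hx => by
    rw [← dist_eq_norm (γ t) x]
    have hsmall := norm_le_mul_min_sub (f := fun t => γ t - Q t)
      (by simp [Q, inscribedPolygon_left γ hab hN]) (by simp [Q, inscribedPolygon_right γ hab hN])
      hclose (by positivity) ht
    have hm := mul_le_mul_of_nonneg_right (min_le_right m₁ m₂) (min_sub_nonneg ht)
    refine hsmall.trans ?_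
    rw [mul_assoc]
    exact mul_le_mul_of_nonneg_left (hm.trans (htr t ht x hx)) hc₀.le
  have harc : ∀ s ∈ Icc a b, ∀ t ∈ Icc a b, ‖(γ s - Q s) - (γ t - Q t)‖ ≤ c * ‖γ s - γ t‖ :=
    fun s hs t ht => by
    have hm := mul_le_mul_of_nonneg_right (min_le_left m₁ m₂) (abs_nonneg (s - t))
    refine (hclose s hs t ht).trans ?_
    rw [mul_assoc, ← dist_eq_norm (γ s)]
    exact mul_le_mul_of_nonneg_left (hm.trans (hlow s hs t ht)) hc₀.le
  obtain ⟨e, he, heS, heγ⟩ := exists_extendsOriented_eqOn hc harc hends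
  refine ⟨N, hN, e, he, heS, ?_⟩
  rw [← image_inscribedPolygon γ hab hN, image_image]
  exact image_congr heγ

end Inscribed

/-! ### Conjugate points of a polynomial near infinity -/

section Branches

open Polynomial

theorem eval_inv_mul_pow_natDegree {K : Type*} [Field K] (p : K[X]) {z : K} (hz : z ≠ 0) :
    p.eval z⁻¹ * z ^ p.natDegree = p.reverse.eval z := by
  let _ : Invertible z⁻¹ := invertibleOfNonzero (inv_ne_zero hz)
  have h := eval₂_reverse_mul_pow (RingHom.id K) z⁻¹ p
  rw [eval₂_id, eval₂_id, invOf_eq_inv, inv_inv] at h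
  rw [← h, inv_pow, mul_assoc, inv_mul_cancel₀ (pow_ne_zero _ hz), mul_one]

theorem exists_analyticAt_rightInverse {𝕜 : Type*} [NontriviallyNormedField 𝕜] [CompleteSpace 𝕜]
    [CharZero 𝕜] {f : 𝕜 → 𝕜} {a : 𝕜} (hf : AnalyticAt 𝕜 f a) (hf' : deriv f a ≠ 0) :
    ∃ g : 𝕜 → 𝕜, AnalyticAt 𝕜 g (f a) ∧ g (f a) = a ∧ ∀ᶠ y in 𝓝 (f a), f (g y) = y :=
  ⟨_, hf.analyticAt_localInverse hf', HasStrictFDerivAt.localInverse_apply_image ..,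
    HasStrictDerivAt.eventually_right_inverse ..⟩

theorem exists_analyticAt_pow_eq {f : ℝ → ℝ} {a : ℝ} (hf : AnalyticAt ℝ f a) (ha : 0 < f a)
    {d : ℕ} (hd : d ≠ 0) :
    ∃ g : ℝ → ℝ, AnalyticAt ℝ g a ∧ (∀ z, 0 < g z) ∧ ∀ᶠ z in 𝓝 a, g z ^ d = f z := by
  refine ⟨fun z => Real.exp (Real.log (f z) / d), (hf.log ha).div_const.rexp',
    fun z => Real.exp_pos _, ?_⟩
  filter_upwards [hf.continuousAt.eventually_const_lt ha] with z hz
  rw [← Real.exp_nat_mul, mul_div_cancel₀ _ (Nat.cast_ne_zero.2 hd), Real.exp_log hz]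

theorem exists_analyticAt_coordinate {p : ℝ[X]} (hp : p.natDegree ≠ 0) :
    ∃ ζ : ℝ → ℝ, AnalyticAt ℝ ζ 0 ∧ deriv ζ 0 ≠ 0 ∧ ζ 0 = 0 ∧
      (∀ z, 0 < z → 0 < ζ z) ∧ (∀ z, ζ z < 0 → z < 0) ∧
      ∀ᶠ z in 𝓝 0, z ≠ 0 → p.eval z⁻¹ * ζ z ^ p.natDegree = p.leadingCoeff := by
  have ha : p.leadingCoeff ≠ 0 := leadingCoeff_ne_zero.2 (by rintro rfl; simp at hp)
  have hreverse : AnalyticAt ℝ (fun z => p.reverse.eval z / p.leadingCoeff) 0 :=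
    (AnalyticOnNhd.eval_polynomial p.reverse 0 (mem_univ 0)).div_const
  obtain ⟨g, hg, hpos, hpow⟩ := exists_analyticAt_pow_eq hreverse
    (by simp [← coeff_zero_eq_eval_zero, coeff_zero_reverse, div_self ha]) hp
  have hginv : AnalyticAt ℝ (fun z => (g z)⁻¹) 0 := hg.fun_inv (hpos 0).ne'
  have hderiv : HasDerivAt (fun z => z * (g z)⁻¹) (g 0)⁻¹ 0 := by
    simpa using (hasDerivAt_id (0 : ℝ)).fun_mul hginv.differentiableAt.hasDerivAt
  refine ⟨fun z => z * (g z)⁻¹, analyticAt_id.fun_mul hginv, ?_, zero_mul _,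
    fun z hz => mul_pos hz (inv_pos.2 (hpos z)),
    fun z hz => neg_of_mul_neg_left hz (inv_pos.2 (hpos z)).le, ?_⟩
  · rw [hderiv.deriv]
    exact inv_ne_zero (hpos 0).ne'
  · filter_upwards [hpow] with z hz hz₀
    rw [eq_div_iff ha] at hz
    rw [mul_pow, ← mul_assoc, eval_inv_mul_pow_natDegree p hz₀, inv_pow, ← hz]
    field_simp [(hpos z).ne']

/-- In the coordinate `1 / t`, the point on the left branch of `p` at infinity where `p` takes the
same value as at a given point of the right branch depends analytically on that point: a coordinate
in which `p` is a multiple of an even power only has to be reflected. -/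
theorem exists_analyticAt_conjugate {p : ℝ[X]} (hp : p.natDegree ≠ 0) (heven : Even p.natDegree) :
    ∃ ι : ℝ → ℝ, AnalyticAt ℝ ι 0 ∧ ι 0 = 0 ∧
      ∀ᶠ z in 𝓝[>] (0 : ℝ), ι z < 0 ∧ p.eval (ι z)⁻¹ = p.eval z⁻¹ := by
  obtain ⟨ζ, hζ, hζ', hζ₀, hζpos, hζneg, hζeval⟩ := exists_analyticAt_coordinate hp
  obtain ⟨θ, hθ, hθ₀, hζθ⟩ := exists_analyticAt_rightInverse hζ hζ'
  rw [hζ₀] at hθ hθ₀ hζθ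
  have hreflect : Tendsto (fun z => -ζ z) (𝓝 0) (𝓝 0) := by
    simpa [hζ₀] using hζ.continuousAt.tendsto.neg
  have hι : AnalyticAt ℝ (fun z => θ (-ζ z)) 0 :=
    AnalyticAt.fun_comp (by simpa [hζ₀] using hθ) hζ.neg
  have hι₀ : θ (-ζ 0) = 0 := by rw [hζ₀, neg_zero, hθ₀]
  have hιtendsto : Tendsto (fun z => θ (-ζ z)) (𝓝 0) (𝓝 0) := by
    simpa only [hι₀] using hι.continuousAt.tendsto
  refine ⟨fun z => θ (-ζ z), hι, hι₀, ?_⟩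
  filter_upwards [hζeval.filter_mono nhdsWithin_le_nhds,
    (hιtendsto.eventually hζeval).filter_mono nhdsWithin_le_nhds,
    (hreflect.eventually hζθ).filter_mono nhdsWithin_le_nhds, self_mem_nhdsWithin]
    with z hz hιz hζι hz₀
  have hζz := hζpos z hz₀
  have hneg : θ (-ζ z) < 0 := hζneg _ (by rw [hζι]; exact neg_neg_of_pos hζz)
  refine ⟨hneg, mul_right_cancel₀ (pow_ne_zero p.natDegree hζz.ne') ?_⟩
  rw [hz hz₀.ne', ← hιz hneg.ne, hζι, heven.neg_pow]

theorem meromorphicAt_polynomial_eval {𝕜 : Type*} [NontriviallyNormedField 𝕜] (q : 𝕜[X])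
    {f : 𝕜 → 𝕜} {x : 𝕜} (hf : MeromorphicAt f x) : MeromorphicAt (fun z => q.eval (f z)) x := by
  induction q using Polynomial.induction_on' with
  | add p q hp hq =>
    simp only [eval_add]
    exact hp.add hq
  | monomial k c =>
    simp only [eval_monomial]
    exact (MeromorphicAt.const c x).mul (hf.pow k)

theorem exists_eventually_eval_ne {ι : Type*} [Finite ι] {P : ι → ℝ[X]}
    (hinj : ∀ s t : ℝ, (∀ j, (P j).eval s = (P j).eval t) → s = t) {f g : ℝ → ℝ} {x : ℝ}
    (hf : MeromorphicAt f x) (hg : MeromorphicAt g x) (hfg : ∀ᶠ z in 𝓝[>] x, f z ≠ g z) :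
    ∃ j, ∀ᶠ z in 𝓝[>] x, (P j).eval (f z) ≠ (P j).eval (g z) := by
  by_contra! hcon
  have heq : ∀ j, ∀ᶠ z in 𝓝[>] x, (P j).eval (f z) = (P j).eval (g z) := fun j =>
    (((meromorphicAt_polynomial_eval (P j) hf).frequently_eq_iff_eventuallyEq
      (meromorphicAt_polynomial_eval (P j) hg)).1 ((hcon j).filter_mono
        (nhdsGT_le_nhdsNE x))).filter_mono (nhdsGT_le_nhdsNE x)
  obtain ⟨z, hz, hne⟩ := ((eventually_all.2 heq).and hfg).exists
  exact hne (hinj _ _ hz)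

theorem exists_eval_ne_of_even {κ : Type*} [Finite κ] {P : κ → ℝ[X]} {i : κ}
    (hinj : ∀ s t : ℝ, (∀ j, (P j).eval s = (P j).eval t) → s = t)
    (hp : (P i).natDegree ≠ 0) (heven : Even (P i).natDegree) {T₀ : ℝ}
    (hT₀ : InjOn (fun t => (P i).eval t) (Iic T₀)) :
    ∃ (j : κ) (T : ℝ), ∀ t ≥ T, ∀ s ≤ T₀, (P i).eval s = (P i).eval t →
      (P j).eval s ≠ (P j).eval t := by
  obtain ⟨ι, hιa, hι₀, hι⟩ := exists_analyticAt_conjugate hp heven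
  have hdistinct : ∀ᶠ z in 𝓝[>] (0 : ℝ), (ι z)⁻¹ ≠ z⁻¹ := by
    filter_upwards [hι, self_mem_nhdsWithin] with z hz hz₀
    exact inv_injective.ne (hz.1.trans hz₀).ne
  obtain ⟨j, hj⟩ := exists_eventually_eval_ne hinj hιa.meromorphicAt.inv
    (MeromorphicAt.id (0 : ℝ)).inv hdistinct
  have hleft : Tendsto ι (𝓝[>] 0) (𝓝[<] 0) := by
    refine tendsto_nhdsWithin_iff.2 ⟨?_, hι.mono fun z hz => hz.1⟩
    have := hιa.continuousAt.tendsto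
    rw [hι₀] at this
    exact this.mono_left nhdsWithin_le_nhds
  have hfar : ∀ᶠ z in 𝓝[>] (0 : ℝ), (ι z)⁻¹ ≤ T₀ :=
    (tendsto_inv_nhdsLT_zero.comp hleft).eventually (eventually_le_atBot T₀)
  obtain ⟨T, hT⟩ := eventually_atTop.1
    (tendsto_inv_atTop_nhdsGT_zero.eventually (hj.and (hι.and hfar)))
  refine ⟨j, T, fun t ht s hs hst => ?_⟩
  obtain ⟨hne, ⟨-, hval⟩, hle⟩ := hT t ht
  simp only [Pi.inv_apply, id, inv_inv] at hne hval
  rwa [hT₀ hs hle (hst.trans hval.symm)]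

end Branches

/-! ### Straightening curves near infinity -/

section Elementary

variable {n : ℕ}

theorem exists_extendsOriented_shear {i : Fin n} {b : ℝ → Euc n} (hb : Continuous b)
    (hbi : ∀ c, b c i = 0) :
    ∃ h : Euc n ≃ₜ Euc n, ExtendsOriented h ∧ ∀ x, h x = x + b (x i) := by
  obtain ⟨h, hh, hx⟩ := exists_extendsOriented_of_isotopy
    (fun q => q.2 + (q.1 : ℝ) • b (q.2 i)) (fun q => q.2 - (q.1 : ℝ) • b (q.2 i))
    (by fun_prop) (by fun_prop) (fun s x => by simp [hbi]) (fun x => by simp [hbi])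
    (fun x => by simp)
  exact ⟨h, hh, fun x => by simp [hx]⟩

theorem exists_extendsOriented_linear_shear {i j : Fin n} (c : ℝ) {d : ℝ → Euc n}
    (hd : Continuous d) (hdi : ∀ y, d y i = 0) (hdj : ∀ y, 0 < 1 + d y j) :
    ∃ h : Euc n ≃ₜ Euc n, ExtendsOriented h ∧ ∀ x, h x = x + (x j - c) • d (x i) := by
  have hpos : ∀ (s : unitInterval) (y : ℝ), 0 < 1 + (s : ℝ) * d y j := by
    intro s y
    have hs₀ := s.2.1
    have hs := s.2.2
    nlinarith [hdj y, mul_nonneg hs₀ (hdj y).le]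
  have hne : ∀ q : unitInterval × Euc n, 1 + (q.1 : ℝ) * d (q.2 i) j ≠ 0 := fun q => (hpos _ _).ne'
  have : Continuous fun q : unitInterval × Euc n => (1 + (q.1 : ℝ) * d (q.2 i) j)⁻¹ :=
    Continuous.inv₀ (by fun_prop) hne
  obtain ⟨h, hh, hx⟩ := exists_extendsOriented_of_isotopy
    (fun q => q.2 + ((q.1 : ℝ) * (q.2 j - c)) • d (q.2 i))
    (fun q => q.2 - ((q.1 : ℝ) * (q.2 j - c) * (1 + (q.1 : ℝ) * d (q.2 i) j)⁻¹) • d (q.2 i))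
    (by fun_prop) (by fun_prop)
    (fun s x => by
      have hs := (hpos s (x i)).ne'
      simp only [PiLp.add_apply, PiLp.smul_apply, hdi, mul_zero, add_zero, smul_eq_mul]
      have : (s : ℝ) * (x j + s * (x j - c) * d (x i) j - c) * (1 + s * d (x i) j)⁻¹ =
          s * (x j - c) := by
        field_simp
        ring
      rw [this, add_sub_cancel_right])
    (fun x => by
      have hs := (hpos 1 (x i)).ne'
      rw [Icc.coe_one, one_mul] at hs
      simp only [PiLp.sub_apply, PiLp.smul_apply, hdi, mul_zero, sub_zero, smul_eq_mul,
        Icc.coe_one, one_mul]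
      have : x j - (x j - c) * (1 + d (x i) j)⁻¹ * d (x i) j - c =
          (x j - c) * (1 + d (x i) j)⁻¹ := by
        field_simp
        ring
      rw [this, sub_add_cancel])
    (fun x => by simp)
  exact ⟨h, hh, fun x => by simp [hx]⟩

/-- The scaling of `ℝⁿ` by the factor `a` in the directions orthogonal to the `i`-th axis. -/
noncomputable def axialScaling (i : Fin n) (a : ℝ) (x : Euc n) : Euc n :=
  a • x + ((1 - a) * x i) • EuclideanSpace.single i (1 : ℝ)

theorem axialScaling_apply_self (i : Fin n) (a : ℝ) (x : Euc n) : axialScaling i a x i = x i := by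
  simp [axialScaling]
  ring

theorem axialScaling_one (i : Fin n) (x : Euc n) : axialScaling i 1 x = x := by
  simp [axialScaling]

theorem axialScaling_axialScaling (i : Fin n) (a b : ℝ) (x : Euc n) :
    axialScaling i a (axialScaling i b x) = axialScaling i (a * b) x := by
  rw [axialScaling, axialScaling_apply_self]
  simp only [axialScaling]
  module

theorem exists_extendsOriented_axialScaling (i : Fin n) {μ : ℝ → ℝ} (hμ : Continuous μ)
    (hpos : ∀ y, 0 < μ y) :
    ∃ h : Euc n ≃ₜ Euc n, ExtendsOriented h ∧ ∀ x, h x = axialScaling i (μ (x i)) x := by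
  let ν : unitInterval → ℝ → ℝ := fun s y => 1 + (s : ℝ) * (μ y - 1)
  have hν : ∀ s y, ν s y ≠ 0 := fun s y => by
    have := s.2.1
    have := s.2.2
    simp only [ν]
    nlinarith [hpos y, mul_nonneg s.2.1 (hpos y).le]
  have hνc : Continuous fun q : unitInterval × Euc n => ν q.1 (q.2 i) := by fun_prop
  have hνi : Continuous fun q : unitInterval × Euc n => (ν q.1 (q.2 i))⁻¹ :=
    hνc.inv₀ fun q => hν _ _
  obtain ⟨h, hh, hx⟩ := exists_extendsOriented_of_isotopy
    (fun q => axialScaling i (ν q.1 (q.2 i)) q.2) (fun q => axialScaling i (ν q.1 (q.2 i))⁻¹ q.2)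
    (by unfold axialScaling; fun_prop) (by unfold axialScaling; fun_prop)
    (fun s x => by
      rw [axialScaling_apply_self, axialScaling_axialScaling, inv_mul_cancel₀ (hν _ _),
        axialScaling_one])
    (fun x => by
      rw [axialScaling_apply_self, axialScaling_axialScaling, mul_inv_cancel₀ (hν _ _),
        axialScaling_one])
    (fun x => by simp [ν, axialScaling_one])
  exact ⟨h, hh, fun x => by simp [hx, ν]⟩

end Elementary

section Ends

variable {n : ℕ} {i : Fin n} {ε δ R : ℝ} {x y : ℝ → Euc n}

theorem mul_self_of_abs_eq_one (hε : |ε| = 1) : ε * ε = 1 := by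
  rw [← abs_mul_abs_self, hε, one_mul]

/-- Beyond the height `R` in the direction `ε` of the `i`-th axis, the continuous curve `x` is
parametrized by its height. -/
structure IsHeightEnd (i : Fin n) (ε R : ℝ) (x : ℝ → Euc n) : Prop where
  continuous : Continuous x
  abs_eq_one : |ε| = 1
  apply_height : ∀ h ≥ R, x h i = ε * h

/-- The ray in the direction of `a` that begins at `a`. -/
def outwardRay {E : Type*} [AddCommGroup E] [Module ℝ E] (a : E) : Set E :=
  (fun r : ℝ => r • a) '' Ici 1

theorem IsHeightEnd.mul_apply_height (hx : IsHeightEnd i ε R x) {h : ℝ} (hh : R ≤ h) :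
    ε * x h i = h := by
  rw [hx.apply_height h hh, ← mul_assoc, mul_self_of_abs_eq_one hx.abs_eq_one, one_mul]

theorem IsHeightEnd.abs_apply_height (hx : IsHeightEnd i ε R x) {h : ℝ} (hh : R ≤ h) :
    |x h i| = |h| := by
  rw [hx.apply_height h hh, abs_mul, hx.abs_eq_one, one_mul]

theorem IsHeightEnd.exists_straighten (hx : IsHeightEnd i ε R x) :
    ∃ H : Euc n ≃ₜ Euc n, ExtendsOriented H ∧ (∀ z, ε * z i ≤ R → H z = z) ∧
      ∀ h ≥ R, ∀ v : Euc n, v i = 0 →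
        H (x h + v) = x R + ((h - R) * ε) • EuclideanSpace.single i (1 : ℝ) + v := by
  let b : ℝ → Euc n := fun c =>
    x R + ((max (ε * c) R - R) * ε) • EuclideanSpace.single i (1 : ℝ) - x (max (ε * c) R)
  have hxc := hx.continuous
  have hbi : ∀ c, b c i = 0 := fun c => by
    simp only [b, PiLp.add_apply, PiLp.sub_apply, PiLp.smul_apply, PiLp.single_apply, if_pos,
      smul_eq_mul, hx.apply_height _ le_rfl, hx.apply_height _ (le_max_right _ _)]
    ring
  obtain ⟨H, hH, hHb⟩ := exists_extendsOriented_shear (b := b) (by fun_prop) hbi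
  refine ⟨H, hH, fun z hz => ?_, fun h hh v hv => ?_⟩
  · simp [hHb, b, max_eq_right hz]
  · rw [hHb, PiLp.add_apply, hv, add_zero]
    simp only [b, hx.mul_apply_height hh, max_eq_left hh]
    abel

theorem div_pos_of_forall_ne_zero {X : Type*} [TopologicalSpace X] {s : Set X}
    (hs : IsPreconnected s) {f : X → ℝ} (hf : ContinuousOn f s) (hne : ∀ x ∈ s, f x ≠ 0) {x y : X}
    (hx : x ∈ s) (hy : y ∈ s) : 0 < f x / f y := by
  have hzero : ∀ {u v : X}, u ∈ s → v ∈ s → ¬(f u < 0 ∧ 0 < f v) := fun hu hv h => by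
    obtain ⟨z, hz, hfz⟩ := hs.intermediate_value hu hv hf ⟨h.1.le, h.2.le⟩
    exact hne z hz hfz
  rcases (hne x hx).lt_or_gt with hfx | hfx <;> rcases (hne y hy).lt_or_gt with hfy | hfy
  · exact div_pos_of_neg_of_neg hfx hfy
  · exact (hzero hx hy ⟨hfx, hfy⟩).elim
  · exact (hzero hy hx ⟨hfy, hfx⟩).elim
  · exact div_pos hfx hfy

/-- The homeomorphism is a shear of each level `z i = ε * h` that is linear with respect to an
origin on the hyperplane `z j = c`. -/
theorem exists_extendsOriented_straighten_beside {w : ℝ → Euc n} (hw : Continuous w)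
    (hε : |ε| = 1) (hwi : ∀ h ≥ R, w h i = 0) {j : Fin n} (hwj : ∀ h ≥ R, w h j ≠ 0) (c : ℝ) :
    ∃ H : Euc n ≃ₜ Euc n, ExtendsOriented H ∧ (∀ z, ε * z i ≤ R → H z = z) ∧
      ∀ h ≥ R, ∀ z, z i = ε * h → z j = c → ∀ r : ℝ, H (z + r • w h) = z + r • w R := by
  let d : ℝ → Euc n := fun y => (w (max (ε * y) R) j)⁻¹ • (w R - w (max (ε * y) R))
  have hd : Continuous d := by
    have : Continuous fun y => (w (max (ε * y) R) j)⁻¹ :=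
      Continuous.inv₀ (by fun_prop) fun y => hwj _ (le_max_right _ _)
    fun_prop
  have hdi : ∀ y, d y i = 0 := fun y => by
    simp [d, hwi R le_rfl, hwi _ (le_max_right (ε * y) R)]
  have hdj : ∀ y, 0 < 1 + d y j := fun y => by
    have hle : max (ε * y) R ∈ Ici R := mem_Ici.2 (le_max_right _ _)
    have hne := hwj _ hle
    have hquot : 1 + d y j = w R j / w (max (ε * y) R) j := by
      simp only [d, PiLp.smul_apply, PiLp.sub_apply, smul_eq_mul]
      field_simp
      ring
    rw [hquot]
    exact div_pos_of_forall_ne_zero (f := fun h => w h j) isPreconnected_Ici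
      (by fun_prop) hwj self_mem_Ici hle
  obtain ⟨H, hH, hHd⟩ := exists_extendsOriented_linear_shear c hd hdi hdj
  refine ⟨H, hH, fun z hz => by simp [hHd, d, max_eq_right hz], fun h hh z hzi hzj r => ?_⟩
  have hlevel : d (ε * h) = (w h j)⁻¹ • (w R - w h) := by
    simp only [d]
    rw [← mul_assoc, mul_self_of_abs_eq_one hε, one_mul, max_eq_left hh]
  have hcoord : (z + r • w h) j - c = r * w h j := by simp [hzj]
  have hheight : (z + r • w h) i = ε * h := by simp [hzi, hwi h hh]
  rw [hHd, hcoord, hheight, hlevel, smul_smul, mul_assoc, mul_inv_cancel₀ (hwj h hh)]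
  module

/-- Straightening `y` moves `x` by a translation of each level, so `x` remains beside the
straightened `y`. -/
theorem IsHeightEnd.exists_straighten_parallel (hx : IsHeightEnd i ε R x)
    (hy : IsHeightEnd i ε R y) {j : Fin n} (hj : ∀ h ≥ R, x h j ≠ y h j) :
    ∃ H : Euc n ≃ₜ Euc n, ExtendsOriented H ∧ (∀ z, ε * z i ≤ R → H z = z) ∧
      (∀ h ≥ R, H (x h) = x R + ((h - R) * ε) • EuclideanSpace.single i (1 : ℝ)) ∧
      ∀ h ≥ R, H (y h) = y R + ((h - R) * ε) • EuclideanSpace.single i (1 : ℝ) := by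
  let w : ℝ → Euc n := fun h => x h - y h
  have hwi : ∀ h ≥ R, w h i = 0 := fun h hh => by
    simp [w, hx.apply_height h hh, hy.apply_height h hh]
  have hwj : ∀ h ≥ R, w h j ≠ 0 := fun h hh => by
    simpa only [w, PiLp.sub_apply] using sub_ne_zero.2 (hj h hh)
  have hji : j ≠ i := by
    rintro rfl
    exact hwj R le_rfl (hwi R le_rfl)
  let line : ℝ → Euc n := fun h => y R + ((h - R) * ε) • EuclideanSpace.single i (1 : ℝ)
  obtain ⟨H₁, hH₁, hfix₁, hline₁⟩ := hy.exists_straighten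
  obtain ⟨H₂, hH₂, hfix₂, hline₂⟩ := exists_extendsOriented_straighten_beside
    (hx.continuous.sub hy.continuous) hx.abs_eq_one hwi hwj (y R j)
  have hboth : ∀ h ≥ R, ∀ r : ℝ, H₂ (H₁ (y h + r • w h)) = line h + r • w R := fun h hh r => by
    rw [hline₁ h hh _ (by simp [hwi h hh])]
    refine hline₂ h hh _ ?_ (by simp [hji]) r
    simp [hy.apply_height R le_rfl]
    ring
  refine ⟨H₁.trans H₂, hH₁.trans hH₂, fun z hz => ?_, fun h hh => ?_, fun h hh => ?_⟩
  · rw [Homeomorph.trans_apply, hfix₁ z hz, hfix₂ z hz]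
  · have hx₁ := hboth h hh 1
    simp only [w, line, one_smul, add_sub_cancel] at hx₁
    rw [Homeomorph.trans_apply, hx₁]
    abel
  · simpa using hboth h hh 0

theorem mul_le_of_abs_le {c : ℝ} (hε : |ε| = 1) (hc : |c| ≤ R) : ε * c ≤ R := by
  rw [← one_mul |c|, ← hε, ← abs_mul] at hc
  exact (le_abs_self _).trans hc

theorem IsHeightEnd.exists_straighten_opposite (hx : IsHeightEnd i ε R x)
    (hy : IsHeightEnd i (-ε) R y) (hR : 0 ≤ R) :
    ∃ H : Euc n ≃ₜ Euc n, ExtendsOriented H ∧ (∀ z, |z i| ≤ R → H z = z) ∧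
      (∀ h ≥ R, H (x h) = x R + ((h - R) * ε) • EuclideanSpace.single i (1 : ℝ)) ∧
      ∀ h ≥ R, H (y h) = y R + ((h - R) * -ε) • EuclideanSpace.single i (1 : ℝ) := by
  obtain ⟨H₁, hH₁, hfix₁, hline₁⟩ := hx.exists_straighten
  obtain ⟨H₂, hH₂, hfix₂, hline₂⟩ := hy.exists_straighten
  have hline₁' : ∀ h ≥ R, H₁ (x h) = x R + ((h - R) * ε) • EuclideanSpace.single i (1 : ℝ) :=
    fun h hh => by simpa using hline₁ h hh 0 rfl
  have hline₂' : ∀ h ≥ R, H₂ (y h) = y R + ((h - R) * -ε) • EuclideanSpace.single i (1 : ℝ) :=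
    fun h hh => by simpa using hline₂ h hh 0 rfl
  refine ⟨H₁.trans H₂, hH₁.trans hH₂, fun z hz => ?_, fun h hh => ?_, fun h hh => ?_⟩
  · rw [Homeomorph.trans_apply, hfix₁ z (mul_le_of_abs_le hx.abs_eq_one hz),
      hfix₂ z (mul_le_of_abs_le hy.abs_eq_one hz)]
  · rw [Homeomorph.trans_apply, hline₁' h hh, hfix₂]
    have : -ε * (ε * R + (h - R) * ε) = -h := by
      linear_combination -h * mul_self_of_abs_eq_one hx.abs_eq_one
    simp [hx.apply_height R le_rfl]
    linarith
  · have := hy.mul_apply_height hh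
    rw [Homeomorph.trans_apply, hfix₁ _ (by linarith), hline₂' h hh]

theorem IsHeightEnd.exists_straighten_pair (hx : IsHeightEnd i ε R x) (hy : IsHeightEnd i δ R y)
    (hR : 0 ≤ R) {j : Fin n} (hj : ∀ h ≥ R, x h j ≠ y h j) :
    ∃ H : Euc n ≃ₜ Euc n, ExtendsOriented H ∧ (∀ z, |z i| ≤ R → H z = z) ∧
      (∀ h ≥ R, H (x h) = x R + ((h - R) * ε) • EuclideanSpace.single i (1 : ℝ)) ∧
      ∀ h ≥ R, H (y h) = y R + ((h - R) * δ) • EuclideanSpace.single i (1 : ℝ) := by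
  rcases abs_eq_abs.1 (hy.abs_eq_one.trans hx.abs_eq_one.symm) with rfl | rfl
  · obtain ⟨H, hH, hfix, hlines⟩ := hx.exists_straighten_parallel hy hj
    exact ⟨H, hH, fun z hz => hfix z (mul_le_of_abs_le hx.abs_eq_one hz), hlines⟩
  · exact hx.exists_straighten_opposite hy hR

theorem image_outwardRay {a : Euc n} (hR : 0 < R) {H : Euc n → Euc n}
    (hH : ∀ h ≥ R, H (x h) = (h / R) • a) : H '' (x '' Ici R) = outwardRay a := by
  have hparam : (fun h => h / R) '' Ici R = Ici 1 := by
    rw [← div_self hR.ne']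
    exact (OrderIso.divRight₀ R hR).image_Ici R
  rw [outwardRay, ← hparam, image_image, image_image]
  exact image_congr hH

/-- After the ends have become straight, the levels are scaled in proportion to their height. -/
theorem IsHeightEnd.exists_radial_pair (hx : IsHeightEnd i ε R x) (hy : IsHeightEnd i δ R y)
    (hR : 0 < R) {j : Fin n} (hj : ∀ h ≥ R, x h j ≠ y h j) {q : Euc n} (hq : q i = 0) :
    ∃ H : Euc n ≃ₜ Euc n, ExtendsOriented H ∧ (∀ z, |z i| ≤ R → H z = z - q) ∧
      H '' (x '' Ici R) = outwardRay (x R - q) ∧ H '' (y '' Ici R) = outwardRay (y R - q) := by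
  obtain ⟨H₁, hH₁, hfix, hlinex, hliney⟩ := hx.exists_straighten_pair hy hR.le hj
  obtain ⟨H₂, hH₂, hH₂q⟩ := exists_extendsOriented_shear (i := i) (b := fun _ => -q)
    continuous_const (fun _ => by simp [hq])
  obtain ⟨H₃, hH₃, hH₃s⟩ := exists_extendsOriented_axialScaling i (μ := fun c => max (|c| / R) 1)
    (by fun_prop) (fun c => lt_max_of_lt_right one_pos)
  have hray : ∀ {z : ℝ → Euc n} {σ : ℝ}, IsHeightEnd i σ R z → ∀ h ≥ R,
      H₃ (H₂ (z R + ((h - R) * σ) • EuclideanSpace.single i (1 : ℝ))) = (h / R) • (z R - q) := by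
    intro z σ hz h hh
    have hi : (z R + ((h - R) * σ) • EuclideanSpace.single i (1 : ℝ) + -q) i = σ * h := by
      simp [hz.apply_height R le_rfl, hq]
      ring
    have hscale : max (|σ * h| / R) 1 = h / R := by
      rw [abs_mul, hz.abs_eq_one, one_mul, abs_of_nonneg (hR.le.trans hh)]
      exact max_eq_left ((one_le_div hR).2 hh)
    have hcancel : (h / R) * ((h - R) * σ) + (1 - h / R) * (σ * h) = 0 := by
      field_simp
      ring
    rw [hH₂q, hH₃s, axialScaling, hi, hscale]
    calc _ = (h / R) • (z R - q) + ((h / R) * ((h - R) * σ) + (1 - h / R) * (σ * h)) •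
          EuclideanSpace.single i (1 : ℝ) := by module
      _ = _ := by rw [hcancel, zero_smul, add_zero]
  refine ⟨(H₁.trans H₂).trans H₃, (hH₁.trans hH₂).trans hH₃, fun z hz => ?_,
    image_outwardRay hR fun h hh => ?_, image_outwardRay hR fun h hh => ?_⟩
  · have hi : (z + -q) i = z i := by simp [hq]
    rw [Homeomorph.trans_apply, Homeomorph.trans_apply, hfix z hz, hH₂q, hH₃s, hi,
      max_eq_right ((div_le_one hR).2 hz), axialScaling_one, sub_eq_add_neg]
  · rw [Homeomorph.trans_apply, Homeomorph.trans_apply, hlinex h hh, hray hx h hh]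
  · rw [Homeomorph.trans_apply, Homeomorph.trans_apply, hliney h hh, hray hy h hh]

end Ends

/-! ### The ends of a polynomial knot -/

section SteepEnds

/-- Beyond `T` the function `ε * f`, where `ε` is a sign, grows with slope at least `m`. -/
structure IsSteepEnd (f : ℝ → ℝ) (ε T m : ℝ) : Prop where
  abs_eq_one : |ε| = 1
  pos : 0 < m
  mul_sub_le : ∀ s ≥ T, ∀ t ≥ s, m * (t - s) ≤ ε * f t - ε * f s

variable {f : ℝ → ℝ} {ε δ T T' m m' : ℝ}

theorem IsSteepEnd.mono (hf : IsSteepEnd f ε T m) (hT : T ≤ T') (hm' : 0 < m') (hm : m' ≤ m) :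
    IsSteepEnd f ε T' m' where
  abs_eq_one := hf.abs_eq_one
  pos := hm'
  mul_sub_le s hs t ht := (mul_le_mul_of_nonneg_right hm (sub_nonneg.2 ht)).trans
    (hf.mul_sub_le s (hT.trans hs) t ht)

theorem IsSteepEnd.strictMonoOn (hf : IsSteepEnd f ε T m) :
    StrictMonoOn (fun t => ε * f t) (Ici T) := fun s hs t _ hst =>
  sub_pos.1 ((mul_pos hf.pos (sub_pos.2 hst)).trans_le (hf.mul_sub_le s hs t hst.le))

theorem IsSteepEnd.image_Ici (hf : IsSteepEnd f ε T m) (hfc : Continuous f) :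
    (fun t => ε * f t) '' Ici T = Ici (ε * f T) := by
  refine Subset.antisymm (image_subset_iff.2 fun t ht =>
    hf.strictMonoOn.monotoneOn self_mem_Ici ht ht) fun h hh => ?_
  have hle : T ≤ T + (h - ε * f T) / m :=
    le_add_of_nonneg_right (div_nonneg (sub_nonneg.2 hh) hf.pos.le)
  have hgrow := hf.mul_sub_le T le_rfl _ hle
  rw [add_sub_cancel_left, mul_div_cancel₀ _ hf.pos.ne', sub_le_sub_iff_right] at hgrow
  obtain ⟨t, ht, hth⟩ := intermediate_value_Icc hle (f := fun t => ε * f t)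
    (by fun_prop) ⟨hh, hgrow⟩
  exact ⟨t, ht.1, hth⟩

theorem IsSteepEnd.exists_continuous_invOn (hf : IsSteepEnd f ε T m) (hfc : Continuous f) :
    ∃ τ : ℝ → ℝ, Continuous τ ∧ MapsTo τ (Ici (ε * f T)) (Ici T) ∧
      InvOn τ (fun t => ε * f t) (Ici T) (Ici (ε * f T)) := by
  let e : Ici T ≃o Ici (ε * f T) :=
    (hf.strictMonoOn.orderIso _ _).trans (OrderIso.setCongr _ _ (hf.image_Ici hfc))
  have he : ∀ t, (e t : ℝ) = ε * f t := fun t => rfl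
  have hproj : Continuous (projIci (ε * f T)) := by unfold projIci; fun_prop
  refine ⟨IciExtend fun h => (e.symm h : ℝ),
    (continuous_subtype_val.comp e.symm.continuous).comp hproj, fun h _ => (e.symm _).2,
    fun t ht => ?_, fun h hh => ?_⟩
  · dsimp only
    rw [← he ⟨t, ht⟩, IciExtend_coe, OrderIso.symm_apply_apply]
  · dsimp only
    rw [IciExtend_of_mem _ hh, ← he, OrderIso.apply_symm_apply]

theorem IsSteepEnd.exists_isHeightEnd {n : ℕ} {i : Fin n} {γ : ℝ → Euc n} {R : ℝ}
    (hγ : IsSteepEnd (fun t => γ t i) ε T m) (hγc : Continuous γ) (hR : ε * γ T i ≤ R) :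
    ∃ x b, IsHeightEnd i ε R x ∧ T ≤ b ∧ x R = γ b ∧ x '' Ici R = γ '' Ici b ∧
      ∀ h ≥ R, ∃ t ≥ T, x h = γ t := by
  obtain ⟨τ, hτc, hmaps, hleft, hright⟩ := hγ.exists_continuous_invOn (by fun_prop)
  have hT : ∀ h ≥ R, T ≤ τ h := fun h hh => hmaps (hR.trans hh)
  have hτ : ∀ h ≥ R, ε * γ (τ h) i = h := fun h hh => hright (hR.trans hh)
  refine ⟨γ ∘ τ, τ R, ⟨hγc.comp hτc, hγ.abs_eq_one, fun h hh => ?_⟩, hT R le_rfl, rfl, ?_,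
    fun h hh => ⟨τ h, hT h hh, rfl⟩⟩
  · nth_rewrite 2 [← hτ h hh]
    rw [← mul_assoc, mul_self_of_abs_eq_one hγ.abs_eq_one, one_mul, Function.comp_apply]
  · have himage : τ '' Ici R = Ici (τ R) := by
      refine Subset.antisymm (image_subset_iff.2 fun h hh => ?_) fun t ht => ?_
      · exact (hγ.strictMonoOn.le_iff_le (hT R le_rfl) (hT h hh)).1
          (by simpa only [hτ R le_rfl, hτ h hh] using mem_Ici.1 hh)
      · have hTt : T ≤ t := (hT R le_rfl).trans ht
        have hle := (hγ.strictMonoOn.le_iff_le (hT R le_rfl) hTt).2 ht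
        dsimp only at hle
        rw [hτ R le_rfl] at hle
        exact ⟨ε * γ t i, hle, hleft hTt⟩
    rw [image_comp, himage]

theorem IsSteepEnd.min_one_le_sub_abs (hf : IsSteepEnd f ε T m) {R b t : ℝ} (hT : |f T| ≤ R - 1)
    (hb : ε * f b = R) (ht : t ∈ Icc T b) : min 1 (m * (b - t)) ≤ R - |f t| := by
  have habs : ∀ s, |ε * f s| = |f s| := fun s => by rw [abs_mul, hf.abs_eq_one, one_mul]
  rw [← habs] at hT ⊢
  have hlow := hf.strictMonoOn.monotoneOn self_mem_Ici ht.1 ht.1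
  have hupp := hf.mul_sub_le t ht.1 b ht.2
  rcases abs_cases (ε * f t) with ⟨h, -⟩ | ⟨h, -⟩
  · exact (min_le_right _ _).trans (by linarith)
  · exact (min_le_left _ _).trans (by linarith [neg_abs_le (ε * f T)])

open Polynomial in
theorem exists_isSteepEnd_eval {p : ℝ[X]} (hp : p.natDegree ≠ 0) (hε : |ε| = 1)
    (hlc : 0 < ε * p.leadingCoeff) : ∃ T m, IsSteepEnd (fun t => p.eval t) ε T m := by
  let p' := (C ε * p).derivative
  have hlead : 0 < p'.leadingCoeff := by
    have hε0 : ε ≠ 0 := left_ne_zero_of_mul hlc.ne'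
    have hdeg : (C ε * p).natDegree ≠ 0 := by rwa [natDegree_C_mul hε0]
    rw [leadingCoeff, natDegree_derivative, coeff_derivative,
      Nat.sub_add_cancel (Nat.pos_of_ne_zero hdeg), coeff_natDegree, leadingCoeff_mul,
      leadingCoeff_C]
    exact mul_pos hlc (by positivity)
  obtain ⟨m, hm, hp'⟩ : ∃ m > 0, ∀ᶠ t in atTop, m ≤ p'.eval t := by
    rcases Nat.eq_zero_or_pos p'.natDegree with hdeg | hdeg
    · refine ⟨p'.leadingCoeff, hlead, .of_forall fun t => ?_⟩
      rw [eq_C_of_natDegree_eq_zero hdeg, eval_C, leadingCoeff_C]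
    · exact ⟨1, one_pos, (tendsto_atTop_of_leadingCoeff_nonneg _
        (natDegree_pos_iff_degree_pos.1 hdeg) hlead.le).eventually_ge_atTop 1⟩
  obtain ⟨T, hT⟩ := eventually_atTop.1 hp'
  refine ⟨T, m, hε, hm, fun s hs t ht => ?_⟩
  have hmean := (convex_Ici T).mul_sub_le_image_sub_of_le_deriv (C ε * p).continuousOn
    (C ε * p).differentiable.differentiableOn (C := m) (fun x hx => ?_) s hs t (hs.le.trans ht) ht
  · simpa only [eval_mul, eval_C] using hmean
  · rw [interior_Ici] at hx
    rw [Polynomial.deriv]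
    exact hT x hx.le

open Polynomial in
theorem exists_isSteepEnd_eval_neg {p : ℝ[X]} (hp : p.natDegree ≠ 0) (hε : |ε| = 1)
    (hlc : 0 < ε * p.leadingCoeff) :
    ∃ T m, IsSteepEnd (fun t => p.eval (-t)) ((-1) ^ p.natDegree * ε) T m := by
  have hneg : (-X : ℝ[X]).natDegree = 1 := by rw [natDegree_neg, natDegree_X]
  have hlead : (p.comp (-X)).leadingCoeff = p.leadingCoeff * (-1) ^ p.natDegree := by
    rw [leadingCoeff_comp (by rw [hneg]; exact one_ne_zero), leadingCoeff_neg, leadingCoeff_X]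
  have hsign : (-1) ^ p.natDegree * ε * (p.comp (-X)).leadingCoeff = ε * p.leadingCoeff := by
    rw [hlead]
    linear_combination ε * p.leadingCoeff * mul_self_of_abs_eq_one (abs_neg_one_pow p.natDegree)
  simpa only [eval_comp, eval_neg, eval_X] using exists_isSteepEnd_eval (p := p.comp (-X))
    (by rwa [natDegree_comp, hneg, mul_one]) (by rw [abs_mul, abs_neg_one_pow, hε, one_mul])
    (hsign ▸ hlc)

open Polynomial in
/-- If the `i`-th coordinate has odd degree, the ends lie on opposite sides of the hyperplane
`z i = 0`, so they never share a level. -/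
theorem exists_eval_ne_of_isSteepEnd {ι : Type*} [Finite ι] {P : ι → ℝ[X]} {i : ι}
    (hinj : ∀ s t : ℝ, (∀ j, (P j).eval s = (P j).eval t) → s = t) (hi : (P i).natDegree ≠ 0)
    (hright : IsSteepEnd (fun t => (P i).eval t) ε T m)
    (hleft : IsSteepEnd (fun t => (P i).eval (-t)) ((-1) ^ (P i).natDegree * ε) T m) :
    ∃ j R, ∀ s ≥ T, ∀ t ≥ T, R ≤ ε * (P i).eval t →
      ε * (P i).eval t = (-1) ^ (P i).natDegree * ε * (P i).eval (-s) →
        (P j).eval t ≠ (P j).eval (-s) := by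
  rcases Nat.even_or_odd (P i).natDegree with heven | hodd
  · rw [heven.neg_one_pow, one_mul] at hleft ⊢
    have hinjOn : InjOn (fun t => (P i).eval t) (Iic (-T)) := fun s hs t ht hst =>
      neg_injective (hleft.strictMonoOn.injOn (mem_Ici.2 (le_neg.1 hs)) (mem_Ici.2 (le_neg.1 ht))
        (by simpa only [neg_neg] using congrArg (ε * ·) hst))
    obtain ⟨j, T', hj⟩ := exists_eval_ne_of_even hinj hi heven hinjOn
    refine ⟨j, ε * (P i).eval (max T T'), fun s hs t ht hR hst => ?_⟩
    have hT't : T' ≤ t := (le_max_right T T').trans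
      ((hright.strictMonoOn.le_iff_le (mem_Ici.2 (le_max_left T T')) ht).1 hR)
    have hε : ε ≠ 0 := abs_ne_zero.1 (hright.abs_eq_one ▸ one_ne_zero)
    exact (hj t hT't (-s) (neg_le_neg hs) (mul_left_cancel₀ hε hst).symm).symm
  · refine ⟨i, 1, fun s _ t _ hR hst heq => ?_⟩
    rw [hodd.neg_one_pow, ← heq] at hst
    linarith

end SteepEnds

section KnotEnds

variable {n : ℕ} {κ : ℝ → Euc n} {i : Fin n} {ε δ T m : ℝ}

/-- Both ends of the curve `κ` leave every slab about the hyperplane `z i = 0` steeply, the right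
end in the direction `ε` and the left end in the direction `δ`, and outside some slab one
coordinate tells them apart on each level. -/
structure HasSteepEnds (κ : ℝ → Euc n) (i : Fin n) (ε δ T m : ℝ) : Prop where
  right : IsSteepEnd (fun t => κ t i) ε T m
  left : IsSteepEnd (fun t => κ (-t) i) δ T m
  separated : ∃ j R, ∀ s ≥ T, ∀ t ≥ T, R ≤ ε * κ t i → ε * κ t i = δ * κ (-s) i → κ t j ≠ κ (-s) j

theorem IsPolynomialKnot.contDiff (hκ : IsPolynomialKnot κ) : ContDiff ℝ 1 κ := by
  obtain ⟨P, hP⟩ := hκ.polynomial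
  refine contDiff_euclidean.2 fun i => ?_
  simp_rw [hP]
  simpa using (P i).contDiff_aeval (𝕜 := ℝ) 1

theorem IsPolynomialKnot.exists_eval (hκ : IsPolynomialKnot κ) :
    ∃ (P : Fin n → Polynomial ℝ) (i : Fin n),
      (∀ t j, κ t j = (P j).eval t) ∧ (P i).natDegree ≠ 0 := by
  obtain ⟨P, hP⟩ := hκ.polynomial
  by_contra! hconst
  refine zero_ne_one (α := ℝ) (hκ.injective (PiLp.ext fun j => ?_))
  rw [hP, hP, Polynomial.eq_C_of_natDegree_eq_zero (hconst P j hP), Polynomial.eval_C,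
    Polynomial.eval_C]

open Polynomial in
theorem IsPolynomialKnot.exists_hasSteepEnds (hκ : IsPolynomialKnot κ) :
    ∃ i ε δ T m, 0 < T ∧ HasSteepEnds κ i ε δ T m := by
  obtain ⟨P, i, hP, hi⟩ := hκ.exists_eval
  have hinj : ∀ s t : ℝ, (∀ j, (P j).eval s = (P j).eval t) → s = t := fun s t h =>
    hκ.injective (PiLp.ext fun j => by rw [hP, hP, h])
  set a := (P i).leadingCoeff
  have ha : a ≠ 0 := leadingCoeff_ne_zero.2 (ne_zero_of_natDegree_gt (Nat.pos_of_ne_zero hi))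
  obtain ⟨ε, hε, hεa⟩ : ∃ ε : ℝ, |ε| = 1 ∧ 0 < ε * a :=
    ⟨|a| / a, by rw [abs_div, abs_abs, div_self (abs_ne_zero.2 ha)],
      by rw [div_mul_cancel₀ _ ha]; exact abs_pos.2 ha⟩
  obtain ⟨T₁, m₁, h₁⟩ := exists_isSteepEnd_eval hi hε hεa
  obtain ⟨T₂, m₂, h₂⟩ := exists_isSteepEnd_eval_neg hi hε hεa
  have hm : 0 < min m₁ m₂ := lt_min h₁.pos h₂.pos
  have hright := h₁.mono ((le_max_left T₁ T₂).trans (le_max_left _ 1)) hm (min_le_left _ _)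
  have hleft := h₂.mono ((le_max_right T₁ T₂).trans (le_max_left _ 1)) hm (min_le_right _ _)
  refine ⟨i, ε, (-1) ^ (P i).natDegree * ε, max (max T₁ T₂) 1, min m₁ m₂,
    one_pos.trans_le (le_max_right _ _), ?_, ?_, ?_⟩
  · simpa only [hP] using hright
  · simpa only [hP] using hleft
  · simpa only [hP] using exists_eval_ne_of_isSteepEnd hinj hi hright hleft

theorem HasSteepEnds.min_one_le_sub_abs (hκ : HasSteepEnds κ i ε δ T m) {R a b t : ℝ}
    (hT : ∀ s ∈ Icc (-T) T, |κ s i| ≤ R - 1) (hT₀ : 0 < T) (ha : δ * κ (-a) i = R)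
    (hb : ε * κ b i = R) (ht : t ∈ Icc (-a) b) :
    min 1 (m * min (t - -a) (b - t)) ≤ R - |κ t i| := by
  have hm := hκ.right.pos.le
  rcases le_total t T with htT | htT
  · rcases le_total (-T) t with hTt | hTt
    · exact (min_le_left _ _).trans (by linarith [hT t ⟨hTt, htT⟩])
    · have hend := hκ.left.min_one_le_sub_abs (hT (-T) ⟨le_rfl, by linarith⟩) ha
        (t := -t) ⟨by linarith, by linarith [ht.1]⟩
      rw [neg_neg] at hend
      refine le_trans (min_le_min_left _ (mul_le_mul_of_nonneg_left ?_ hm)) hend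
      exact (min_le_left _ _).trans (by linarith)
  · exact le_trans (min_le_min_left _ (mul_le_mul_of_nonneg_left (min_le_right _ _) hm))
      (hκ.right.min_one_le_sub_abs (hT T ⟨by linarith, le_rfl⟩) hb ⟨htT, ht.2⟩)

theorem HasSteepEnds.exists_isHeightEnd (hκ : HasSteepEnds κ i ε δ T m) (hκc : Continuous κ)
    (hT : 0 < T) :
    ∃ R A B x y, 0 < R ∧ A < B ∧ IsHeightEnd i ε R x ∧ IsHeightEnd i δ R y ∧
      (∃ j, ∀ h ≥ R, x h j ≠ y h j) ∧ x R = κ B ∧ y R = κ A ∧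
      x '' Ici R = κ '' Ici B ∧ y '' Ici R = κ '' Iic A ∧
      ∀ t ∈ Icc A B, min 1 (m * min (t - A) (B - t)) ≤ R - |κ t i| := by
  obtain ⟨j, R₀, hj⟩ := hκ.separated
  obtain ⟨M, hM⟩ := isCompact_Icc.exists_bound_of_continuousOn (s := Icc (-T) T)
    (f := fun t => κ t i) (by fun_prop)
  have hTR : ∀ s ∈ Icc (-T) T, |κ s i| ≤ max (M + 1) R₀ - 1 := fun s hs =>
    le_sub_iff_add_le.2 ((add_le_add_left (hM s hs) 1).trans (le_max_left _ _))
  have hTmem : T ∈ Icc (-T) T := ⟨by linarith, le_rfl⟩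
  have hTmem' : -T ∈ Icc (-T) T := ⟨le_rfl, by linarith⟩
  have hR : 0 < max (M + 1) R₀ := by linarith [hTR T hTmem, abs_nonneg (κ T i)]
  obtain ⟨x, B, hx, hTB, hxB, hximage, hxmem⟩ := hκ.right.exists_isHeightEnd hκc
    (mul_le_of_abs_le hκ.right.abs_eq_one ((hTR T hTmem).trans (sub_le_self _ zero_le_one)))
  obtain ⟨y, A, hy, hTA, hyA, hyimage, hymem⟩ := hκ.left.exists_isHeightEnd
    (γ := fun t => κ (-t)) (by fun_prop)
    (mul_le_of_abs_le hκ.left.abs_eq_one ((hTR _ hTmem').trans (sub_le_self _ zero_le_one)))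
  refine ⟨max (M + 1) R₀, -A, B, x, y, hR, by linarith, hx, hy, ⟨j, fun h hh => ?_⟩, hxB, hyA,
    hximage, ?_, fun t ht => hκ.min_one_le_sub_abs hTR hT ?_ ?_ ht⟩
  · obtain ⟨t, ht, hxt⟩ := hxmem h hh
    obtain ⟨s, hs, hys⟩ := hymem h hh
    have hth : ε * κ t i = h := hxt ▸ hx.mul_apply_height hh
    have hsh : δ * κ (-s) i = h := hys ▸ hy.mul_apply_height hh
    rw [hxt, hys]
    exact hj s hs t ht (hth ▸ (le_max_right _ _).trans hh) (hth.trans hsh.symm)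
  · rw [hyimage, ← image_neg_Ici, image_image]
  · exact hyA ▸ hy.mul_apply_height le_rfl
  · exact hxB ▸ hx.mul_apply_height le_rfl

theorem isTransverseAtEnds_of_coordinate {γ : ℝ → Euc n} {a b R : ℝ} {S : Set (Euc n)} (hm : 0 < m)
    (hγ : ∀ t ∈ Icc a b, min 1 (m * min (t - a) (b - t)) ≤ R - |γ t i|)
    (hS : ∀ x ∈ S, R ≤ |x i|) : IsTransverseAtEnds γ a b S := by
  have hlen : 0 < |b - a| + 1 := by positivity
  refine ⟨min m (|b - a| + 1)⁻¹, lt_min hm (inv_pos.2 hlen), fun t ht x hx => ?_⟩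
  have hmin := min_sub_nonneg ht
  have hmin' : min (t - a) (b - t) ≤ |b - a| + 1 :=
    (min_le_left _ _).trans (by linarith [ht.2, le_abs_self (b - a)])
  calc min m (|b - a| + 1)⁻¹ * min (t - a) (b - t)
      ≤ min 1 (m * min (t - a) (b - t)) := by
        refine le_min ?_ (mul_le_mul_of_nonneg_right (min_le_left _ _) hmin)
        exact (mul_le_mul (min_le_right _ _) hmin' hmin (inv_nonneg.2 hlen.le)).trans
          (inv_mul_cancel₀ hlen.ne').le
    _ ≤ R - |γ t i| := hγ t ht
    _ ≤ |x i| - |γ t i| := sub_le_sub_right (hS x hx) _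
    _ ≤ |x i - γ t i| := abs_sub_abs_le_abs_sub _ _
    _ ≤ dist x (γ t) := by
        rw [dist_eq_norm]
        exact PiLp.norm_apply_le (x - γ t) i
    _ = dist (γ t) x := dist_comm _ _

theorem exists_apply_eq_zero_forall_sub_ne_zero (hn : 2 ≤ n) {γ : ℝ → Euc n} (hγ : Continuous γ)
    (i : Fin n) (a b : ℝ) : ∃ q : Euc n, q i = 0 ∧ ∀ t ∈ Icc a b, γ t - q ≠ 0 := by
  obtain ⟨c, hc⟩ := isCompact_Icc.exists_bound_of_continuousOn (s := Icc a b) hγ.continuousOn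
  have : Nontrivial (Fin n) := Fin.nontrivial_iff_two_le.2 hn
  obtain ⟨j, hj⟩ := exists_ne i
  refine ⟨EuclideanSpace.single j (|c| + 1), by simp [hj.symm], fun t ht hzero => ?_⟩
  have hbound := hc t ht
  rw [sub_eq_zero.1 hzero, PiLp.norm_single, Real.norm_of_nonneg (by positivity)] at hbound
  linarith [le_abs_self c]

theorem le_abs_apply_of_mem_outwardRay {a z : Euc n} (hz : z ∈ outwardRay a) : |a i| ≤ |z i| := by
  obtain ⟨r, hr, rfl⟩ := hz
  rw [PiLp.smul_apply, smul_eq_mul, abs_mul, abs_of_nonneg (zero_le_one.trans (mem_Ici.1 hr))]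
  exact le_mul_of_one_le_left (abs_nonneg _) hr

theorem IsPolynomialKnot.exists_radial_ends (hn : 2 ≤ n) (hκ : IsPolynomialKnot κ) :
    ∃ (H : Euc n ≃ₜ Euc n) (q : Euc n) (A B : ℝ), ExtendsOriented H ∧ A < B ∧
      (∀ t ∈ Icc A B, κ t - q ≠ 0) ∧
      H '' range κ = (fun t => κ t - q) '' Icc A B ∪
        (outwardRay (κ A - q) ∪ outwardRay (κ B - q)) ∧
      IsTransverseAtEnds (fun t => κ t - q) A B
        (outwardRay (κ A - q) ∪ outwardRay (κ B - q)) := by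
  have hκc := hκ.contDiff.continuous
  obtain ⟨i, ε, δ, T, m, hT, hends⟩ := hκ.exists_hasSteepEnds
  obtain ⟨R, A, B, x, y, hR, hAB, hx, hy, ⟨j, hj⟩, hxB, hyA, hximage, hyimage, hmargin⟩ :=
    hends.exists_isHeightEnd hκc hT
  obtain ⟨q, hqi, hq⟩ := exists_apply_eq_zero_forall_sub_ne_zero hn hκc i A B
  obtain ⟨H, hH, hslab, hHx, hHy⟩ := hx.exists_radial_pair hy hR hj hqi
  have hcover : range κ = κ '' Icc A B ∪ (κ '' Iic A ∪ κ '' Ici B) := by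
    rw [← image_union, ← image_union, ← image_univ, union_comm (Iic A), ← union_assoc,
      Icc_union_Ici_eq_Ici hAB.le, Ici_union_Iic]
  have hmiddle : H '' (κ '' Icc A B) = (fun t => κ t - q) '' Icc A B := by
    rw [image_image]
    refine image_congr fun t ht => hslab _ (sub_nonneg.1 (le_trans ?_ (hmargin t ht)))
    exact le_min zero_le_one (mul_nonneg hends.right.pos.le (min_sub_nonneg ht))
  refine ⟨H, q, A, B, hH, hAB, hq, ?_, ?_⟩
  · rw [hcover, image_union, image_union, hmiddle, ← hyimage, ← hximage, hHx, hHy, hxB, hyA]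
  · refine isTransverseAtEnds_of_coordinate (i := i) hends.right.pos
      (by simpa only [PiLp.sub_apply, hqi, sub_zero] using hmargin) fun z hz => ?_
    have hRabs : ∀ {w : Euc n}, |w i| = |R| → R ≤ |(w - q) i| := fun hw => by
      rw [PiLp.sub_apply, hqi, sub_zero, hw]
      exact le_abs_self R
    rcases hz with hz | hz
    · exact (hRabs (hyA ▸ hy.abs_apply_height le_rfl)).trans (le_abs_apply_of_mem_outwardRay hz)
    · exact (hRabs (hxB ▸ hx.abs_apply_height le_rfl)).trans (le_abs_apply_of_mem_outwardRay hz)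

end KnotEnds

/-! ### The completion of a polynomial knot -/

section Completion

variable {n : ℕ} {κ : ℝ → Euc n}

theorem completion_northPole : completion κ (northPole 1) = northPole n := if_pos rfl

theorem completion_stereoInv (x : Euc 1) : completion κ (stereoInv x) = stereoInv (κ (x 0)) := by
  rw [completion, if_neg (stereoInv_ne_northPole x)]
  exact congrArg (fun t => stereoInv (κ t)) (stereoInv_castSucc_div x 0)

theorem completion_comp_stereoHomeo :
    completion κ ∘ stereoHomeo 1 = stereoHomeo n ∘ OnePoint.map fun x : Euc 1 => κ (x 0) := by
  funext p
  induction p using OnePoint.rec with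
  | infty => exact completion_northPole
  | coe x => exact completion_stereoInv x

theorem range_completion : range (completion κ) = insert (northPole n) (stereoInv '' range κ) := by
  refine Subset.antisymm (range_subset_iff.2 fun y => ?_) ?_
  · by_cases hy : y = northPole 1
    · exact .inl (hy ▸ completion_northPole)
    · obtain ⟨x, rfl⟩ := exists_stereoInv_eq hy
      exact .inr ⟨_, mem_range_self _, (completion_stereoInv x).symm⟩
  · rintro _ (rfl | ⟨_, ⟨t, rfl⟩, rfl⟩)
    · exact ⟨_, completion_northPole⟩
    · exact ⟨stereoInv (WithLp.toLp 2 fun _ => t), completion_stereoInv _⟩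

theorem IsPolynomialKnot.tendsto_cocompact (hκ : IsPolynomialKnot κ) :
    Tendsto κ (cocompact ℝ) (cocompact (Euc n)) := by
  obtain ⟨P, i, hP, hi⟩ := hκ.exists_eval
  rw [← Metric.cobounded_eq_cocompact (α := Euc n), ← tendsto_norm_atTop_iff_cobounded]
  refine tendsto_atTop_mono (fun t => PiLp.norm_apply_le (κ t) i) ?_
  simp_rw [hP]
  exact Polynomial.tendsto_norm_atTop _
    (Polynomial.natDegree_pos_iff_degree_pos.1 (Nat.pos_of_ne_zero hi)) tendsto_norm_cocompact_atTop

theorem isTopologicalKnot_completion (hκ : Continuous κ) (hinj : Function.Injective κ)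
    (hproper : Tendsto κ (cocompact ℝ) (cocompact (Euc n))) :
    IsTopologicalKnot (completion κ) := by
  let coord : Euc 1 ≃ₜ ℝ :=
    (EuclideanSpace.equiv (Fin 1) ℝ).toHomeomorph.trans (Homeomorph.funUnique (Fin 1) ℝ)
  have hfactor : completion κ =
      stereoHomeo n ∘ OnePoint.map (κ ∘ coord) ∘ (stereoHomeo 1).symm := by
    rw [← Function.comp_assoc]
    exact (stereoHomeo 1).toEquiv.eq_comp_symm _ _ |>.2 completion_comp_stereoHomeo
  rw [IsTopologicalKnot, hfactor]
  have hcont : Continuous (OnePoint.map (κ ∘ coord)) :=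
    OnePoint.continuous_map (hκ.comp coord.continuous)
      (by simpa only [coclosedCompact_eq_cocompact] using
        hproper.comp coord.isClosedEmbedding.tendsto_cocompact)
  have hinj' : Function.Injective (OnePoint.map (κ ∘ coord)) :=
    Option.map_injective (hinj.comp coord.injective)
  exact (stereoHomeo n).isEmbedding.comp
    ((hcont.isClosedEmbedding hinj').isEmbedding.comp (stereoHomeo 1).symm.isEmbedding)

theorem IsTopologicalKnot.isTame_of_image_eq {α : Sph 1 → Sph n} (hα : IsTopologicalKnot α)
    {g : Sph n ≃ₜ Sph n} (hg : IsOrientationPreserving g) {k : ℕ} {P : Polygon (Euc n) k}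
    (himage : g '' range α = stereoInv '' P.boundary ℝ) : IsTame α :=
  ⟨hα, g ∘ α, ⟨g.isEmbedding.comp hα, k, P, by rw [range_comp, himage]⟩,
    .refl _, g.symm, .refl 1, hg.symm, funext fun y => by simp⟩

theorem image_insert_northPole {g : Sph n → Sph n} {H : Euc n → Euc n}
    (hg : g (northPole n) = northPole n) (hgH : ∀ x, g (stereoInv x) = stereoInv (H x))
    (S : Set (Euc n)) :
    g '' insert (northPole n) (stereoInv '' S) = insert (northPole n) (stereoInv '' (H '' S)) := by
  rw [image_insert_eq, hg, image_image, image_image]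
  simp only [hgH]

end Completion

section Inversion

variable {n : ℕ} {γ : ℝ → Euc n} {a b : ℝ}

theorem halfTurn_image_insert_northPole (i : Fin n) {S : Set (Euc n)} (hS : ∀ x ∈ S, x ≠ 0) :
    halfTurn i '' insert (northPole n) (stereoInv '' S) =
      stereoInv '' insert 0 (reflectedInversion i '' S) := by
  rw [image_insert_eq, halfTurn_northPole, image_insert_eq, image_image, image_image]
  exact congrArg _ (image_congr fun x hx => halfTurn_stereoInv i (hS x hx))

theorem ne_zero_of_mem_outwardRay {E : Type*} [NormedAddCommGroup E] [NormedSpace ℝ E] {v x : E}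
    (hv : v ≠ 0) (hx : x ∈ outwardRay v) : x ≠ 0 := by
  obtain ⟨r, hr, rfl⟩ := hx
  exact smul_ne_zero (one_pos.trans_le (mem_Ici.1 hr)).ne' hv

theorem insert_zero_reflectedInversion_image_outwardRay (i : Fin n) (v : Euc n) :
    insert 0 (reflectedInversion i '' outwardRay v) = segment ℝ 0 (reflectedInversion i v) := by
  have hinv : (fun r : ℝ => r⁻¹) '' Ici 1 = Ioc 0 1 := by
    refine Subset.antisymm (image_subset_iff.2 fun r hr => ?_) fun s hs => ?_
    · exact ⟨inv_pos.2 (one_pos.trans_le hr), inv_le_one_of_one_le₀ hr⟩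
    · exact ⟨s⁻¹, one_le_inv_iff₀.2 hs, inv_inv s⟩
  have hray : reflectedInversion i '' outwardRay v =
      (fun s : ℝ => s • reflectedInversion i v) '' Ioc 0 1 := by
    rw [← hinv, outwardRay, image_image, image_image]
    simp only [reflectedInversion_smul]
  rw [hray, segment_eq_image', ← Ioc_insert_left zero_le_one, image_insert_eq]
  simp only [sub_zero, zero_add, zero_smul]

theorem IsRegularArc.sub_const {E : Type*} [NormedAddCommGroup E] [NormedSpace ℝ E] {γ : ℝ → E}
    (hγ : IsRegularArc γ a b) (q : E) : IsRegularArc (fun t => γ t - q) a b where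
  contDiffAt t ht := (hγ.contDiffAt t ht).sub contDiffAt_const
  injOn s hs t ht hst := hγ.injOn hs ht (sub_left_injective hst)
  deriv_ne_zero t ht := by simpa only [deriv_sub_const] using hγ.deriv_ne_zero t ht

theorem IsRegularArc.comp_reflectedInversion (hγ : IsRegularArc γ a b) (i : Fin n)
    (hne : ∀ t ∈ Icc a b, γ t ≠ 0) : IsRegularArc (fun t => reflectedInversion i (γ t)) a b where
  contDiffAt t ht := (contDiffAt_reflectedInversion i (hne t ht)).comp t (hγ.contDiffAt t ht)
  injOn s hs t ht hst := hγ.injOn hs ht ((reflectedInversion_involutive i).injective hst)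
  deriv_ne_zero t ht hzero := by
    have hΓ := (((contDiffAt_reflectedInversion i (hne t ht)).comp t
      (hγ.contDiffAt t ht)).differentiableAt one_ne_zero).hasDerivAt
    have hJ := ((contDiffAt_reflectedInversion i (reflectedInversion_ne_zero i
      (hne t ht))).differentiableAt one_ne_zero).hasFDerivAt
    have hγ' := hJ.comp_hasDerivAt t hΓ
    rw [show deriv (reflectedInversion i ∘ γ) t = 0 from hzero, map_zero] at hγ'
    refine hγ.deriv_ne_zero t ht (hγ'.congr_of_eventuallyEq (.of_forall fun s => ?_)).deriv
    exact (reflectedInversion_involutive i (γ s)).symm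

theorem div_le_dist_reflectedInversion (i : Fin n) {x y : Euc n} (hx : x ≠ 0) {c d D : ℝ}
    (hxc : ‖x‖ ≤ c) (hd : 0 ≤ d) (hdD : d ≤ D) (hxy : d ≤ dist x y) :
    d / (c * (D + c)) ≤ dist (reflectedInversion i x) (reflectedInversion i y) := by
  have hx₀ : 0 < ‖x‖ := norm_pos_iff.2 hx
  have hc : 0 < c := hx₀.trans_le hxc
  have hD : 0 ≤ D := hd.trans hdD
  rcases eq_or_ne y 0 with rfl | hy
  · have hzero : reflectedInversion i 0 = 0 := norm_eq_zero.1 (by simp [norm_reflectedInversion])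
    rw [hzero, dist_zero_right, norm_reflectedInversion]
    calc d / (c * (D + c)) ≤ (D + c) / (c * (D + c)) := by gcongr; linarith
      _ = c⁻¹ := by
        have : D + c ≠ 0 := by linarith
        field_simp
      _ ≤ ‖x‖⁻¹ := by gcongr
  · have hyc : ‖y‖ ≤ dist x y + c := by
      have := norm_sub_le x (x - y)
      rw [sub_sub_cancel, ← dist_eq_norm] at this
      linarith
    have : 0 < ‖y‖ := norm_pos_iff.2 hy
    rw [dist_reflectedInversion i hx hy]
    calc d / (c * (D + c)) ≤ d / (c * (d + c)) := by gcongr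
      _ ≤ dist x y / (c * (dist x y + c)) := by
        rw [div_le_div_iff₀ (by positivity) (by positivity)]
        nlinarith [mul_le_mul_of_nonneg_left hxy (mul_pos hc hc).le]
      _ ≤ dist x y / (‖x‖ * ‖y‖) := by gcongr

theorem IsTransverseAtEnds.image_reflectedInversion {S : Set (Euc n)}
    (hS : IsTransverseAtEnds γ a b S) (i : Fin n) (hγ : ContinuousOn γ (Icc a b))
    (hne : ∀ t ∈ Icc a b, γ t ≠ 0) :
    IsTransverseAtEnds (fun t => reflectedInversion i (γ t)) a b (reflectedInversion i '' S) := by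
  obtain ⟨m, hm, hS⟩ := hS
  obtain ⟨c, hc⟩ := isCompact_Icc.exists_bound_of_continuousOn hγ
  have : 0 < max c 1 := lt_max_of_lt_right one_pos
  refine ⟨m / (max c 1 * (m * |b - a| + max c 1)), by positivity, ?_⟩
  rintro t ht _ ⟨x, hx, rfl⟩
  have hmin : min (t - a) (b - t) ≤ |b - a| :=
    (min_le_left _ _).trans (by linarith [ht.2, le_abs_self (b - a)])
  rw [div_mul_eq_mul_div]
  exact div_le_dist_reflectedInversion i (hne t ht) ((hc t ht).trans (le_max_left _ _))
    (mul_nonneg hm.le (min_sub_nonneg ht)) (mul_le_mul_of_nonneg_left hmin hm.le) (hS t ht x hx)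

end Inversion

section ClosedPolygon

theorem polygon_cons_boundary {E : Type*} [NormedAddCommGroup E] [NormedSpace ℝ E] (o : E)
    (w : ℕ → E) (N : ℕ) :
    (⟨Fin.cons o fun k : Fin (N + 1) => w k⟩ : Polygon E (N + 2)).boundary ℝ =
      (segment ℝ o (w 0) ∪ segment ℝ o (w N)) ∪ ⋃ k < N, segment ℝ (w k) (w (k + 1)) := by
  have hfirst : finRotate (N + 2) 0 = Fin.succ 0 := by simp
  have hmid (k : Fin N) : finRotate (N + 2) k.castSucc.succ = k.succ.succ := by
    rw [Fin.succ_castSucc, finRotate_apply, Fin.coeSucc_eq_succ]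
  have hlast : finRotate (N + 2) (Fin.last N).succ = 0 := finRotate_last
  ext x
  simp only [Polygon.boundary, Polygon.edgeSet, affineSegment_eq_segment, mem_iUnion, mem_union]
  rw [Fin.exists_fin_succ, Fin.exists_fin_succ']
  simp only [hfirst, hmid, hlast, Fin.cons_zero, Fin.cons_succ, Fin.val_zero, Fin.val_last,
    Fin.val_castSucc, Fin.val_succ, Fin.exists_iff, exists_prop, segment_symm ℝ (w N) o]
  exact (or_congr_right or_comm).trans or_assoc.symm

end ClosedPolygon

theorem IsRegularArc.exists_image_eq_polygon {n : ℕ} (i : Fin n) {γ : ℝ → Euc n} {a b : ℝ}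
    (hγ : IsRegularArc γ a b) (hab : a < b) (hne : ∀ t ∈ Icc a b, γ t ≠ 0)
    (hrays : IsTransverseAtEnds γ a b (outwardRay (γ a) ∪ outwardRay (γ b))) :
    ∃ (g : Sph n ≃ₜ Sph n) (k : ℕ) (P : Polygon (Euc n) k), IsOrientationPreserving g ∧
      g '' insert (northPole n)
        (stereoInv '' (γ '' Icc a b ∪ (outwardRay (γ a) ∪ outwardRay (γ b)))) =
      stereoInv '' P.boundary ℝ := by
  have hγab : ∀ x ∈ γ '' Icc a b ∪ (outwardRay (γ a) ∪ outwardRay (γ b)), x ≠ 0 := by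
    rintro x (⟨t, ht, rfl⟩ | hx | hx)
    · exact hne t ht
    · exact ne_zero_of_mem_outwardRay (hne a (left_mem_Icc.2 hab.le)) hx
    · exact ne_zero_of_mem_outwardRay (hne b (right_mem_Icc.2 hab.le)) hx
  let Γ : ℝ → Euc n := fun t => reflectedInversion i (γ t)
  let S : Set (Euc n) := segment ℝ 0 (Γ a) ∪ segment ℝ 0 (Γ b)
  have hS : S = insert 0 (reflectedInversion i '' (outwardRay (γ a) ∪ outwardRay (γ b))) := by
    rw [image_union, insert_union_distrib, insert_zero_reflectedInversion_image_outwardRay,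
      insert_zero_reflectedInversion_image_outwardRay]
  have hT : IsTransverseAtEnds Γ a b S := by
    have hΓ := hγ.comp_reflectedInversion i hne
    rw [hS, insert_eq]
    exact (isTransverseAtEnds_singleton hΓ.continuousOn fun t ht =>
      reflectedInversion_ne_zero i (hne t ht)).union
        (hrays.image_reflectedInversion i hγ.continuousOn hne)
  obtain ⟨N, hN, e, ⟨g, hg, -, hge⟩, heS, he⟩ :=
    (hγ.comp_reflectedInversion i hne).exists_extendsOriented_inscribed hab hT
  let P : Polygon (Euc n) (N + 2) := ⟨Fin.cons 0 fun k : Fin (N + 1) => Γ (partitionPoint a b N k)⟩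
  have hboundary : e '' (S ∪ Γ '' Icc a b) = P.boundary ℝ := by
    rw [polygon_cons_boundary 0 fun k => Γ (partitionPoint a b N k), partitionPoint_zero,
      partitionPoint_self a b hN, image_union, he, EqOn.image_eq_self heS]
  refine ⟨(halfTurn i).trans g, N + 2, P, (isOrientationPreserving_halfTurn i).trans hg,
    (image_comp g (halfTurn i) _).trans ?_⟩
  rw [halfTurn_image_insert_northPole i hγab, image_comm hge, image_union, ← union_insert, ← hS,
    image_image (reflectedInversion i), union_comm, ← hboundary]

theorem mainTheorem5 (n : ℕ) (hn : 2 ≤ n) (κ : ℝ → Euc n) (hκ : IsPolynomialKnot κ) :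
    IsTame (completion κ) := by
  have hκcont : Continuous κ := hκ.contDiff.continuous
  obtain ⟨H, q, A, B, ⟨g₁, hg₁, hg₁pole, hg₁H⟩, hAB, hne, himage, hrays⟩ :=
    hκ.exists_radial_ends hn
  have harc : IsRegularArc (fun t => κ t - q) A B :=
    IsRegularArc.sub_const ⟨fun _ _ => hκ.contDiff.contDiffAt, hκ.injective.injOn,
      fun t _ => hκ.deriv_ne_zero t⟩ q
  obtain ⟨g₂, k, P, hg₂, hP⟩ := harc.exists_image_eq_polygon ⟨0, by omega⟩ hAB hne hrays
  refine (isTopologicalKnot_completion hκcont hκ.injective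
    hκ.tendsto_cocompact).isTame_of_image_eq (hg₁.trans hg₂) (P := P) ?_
  refine (image_comp g₂ g₁ _).trans ?_
  rw [range_completion, image_insert_northPole hg₁pole hg₁H, himage, hP]
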